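/- Fix an integer $d\ge 1$ and $p\in(0,1)$. The $d$-dimensional East model on $\mathbb Z^d$ is the following dynamics $(\eta_s)_{s\ge 0}$ on $\{0,1\}^{\mathbb Z^d}$. Independently for each site $x$ there are a sequence of times $0=t_{x,0}<t_{x,1}<t_{x,2}<\cdots$ whose increments are independent exponential variables of parameter $1$, and an independent sequence $(B_{x,n})_{n\ge1}$ of independent Bernoulli variables of parameter $p$; at each time $t_{x,n}$ such that $\eta_{t_{x,n}}(x-e_i)=0$ for some vector $e_i$ of the canonical basis, the spin at $x$ is replaced by $B_{x,n}$, and the spin at $x$ does not change otherwise. Write $\mathbb P_\eta$ for the law of the dynamics started from the configuration $\eta$. For $t\ge0$ and $\alpha>0$ put $$D(t,\alpha)=\{-\lfloor 2d\alpha t\rfloor,\dots,0\}^d,\qquad \mathcal T_t(x)=\int_0^t \mathbf 1_{\{\eta_s(x)=0\}}\,\mathrm ds,\qquad \mathcal G=\Bigl\{\exists x\in D(t,\alpha):\ \mathcal T_t(x)\ge \tfrac{1-p}{4}\,t\Bigr\}.$$ Proposition. For every $\alpha>0$ there exist constants $c_3>0$ and $C_3>0$, depending only on $d$, $p$ and $\alpha$,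 such that for every $t\ge 0$ and every $\eta\in\{0,1\}^{\mathbb Z^d}$ for which some $x\in\{-\lfloor\alpha t\rfloor,\dots,0\}^d$ has $\eta(x)=0$, $$\mathbb P_\eta(\mathcal G^c)\le C_3\,e^{-c_3 t}.$$ -/

import Mathlib

open MeasureTheory ProbabilityTheory

namespace EastModel

/-- The sites of `ℤ^d`. -/
abbrev Site (d : ℕ) : Type := Fin d → ℤ

/-- The configurations: assignments of a spin `0` or `1` to every site of `ℤ^d`. -/
abbrev Config (d : ℕ) : Type := Site d → Fin 2

/-- The vector `e_i` of the canonical basis. -/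
def e {d : ℕ} (i : Fin d) : Site d := Pi.single i 1

/-- The box `{-⌊r⌋, …, 0}^d`. -/
def box (d : ℕ) (r : ℝ) : Set (Site d) := {x | ∀ i, -⌊r⌋ ≤ x i ∧ x i ≤ 0}

/-- The time of the `(n+1)`-st ring of the clock at `x`: the sum of the waiting times `gap x 0`,
…, `gap x n`. -/
noncomputable def ringTime {d : ℕ} (gap : Site d → ℕ → ℝ) (x : Site d) (n : ℕ) : ℝ :=
  ∑ k ∈ Finset.range (n + 1), gap x k

/-- The randomness of the dynamics: the waiting times `gap x n` are exponential of parameter `1`,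
the variables `coin x n` are Bernoulli of parameter `p`, and all of these (for all sites `x`, all
`n`, and both kinds) are mutually independent. -/
structure IsGraphicalConstruction {d : ℕ} {Ω : Type*} [MeasurableSpace Ω] (P : Measure Ω) (p : ℝ)
    (gap : Site d → ℕ → Ω → ℝ) (coin : Site d → ℕ → Ω → Fin 2) : Prop where
  measurable_gap : ∀ x n, Measurable (gap x n)
  measurable_coin : ∀ x n, Measurable (coin x n)
  gap_law : ∀ x n, P.map (gap x n) = expMeasure 1
  coin_law : ∀ x n, P {ω | coin x n ω = 1} = ENNReal.ofReal p
  iIndepFun_pair :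
    iIndepFun (fun (k : Site d × ℕ) ω => (gap k.1 k.2 ω, coin k.1 k.2 ω)) P
  indepFun_gap_coin : ∀ x n, IndepFun (gap x n) (coin x n) P

/-- The evolution rule, for given ring times `τ x n` and given values `b x n`. The path `ξ` (of
which only the times `s ≥ 0` matter) starts from `η`; when the clock at `x` rings for the
`(n+1)`-st time and one of the `x - e_i` is at zero, the spin at `x` is replaced by `b x n`; and
the spin at `x` does not change during a time interval without such an accepted ring at `x`. -/
structure IsEastPath {d : ℕ} (τ : Site d → ℕ → ℝ) (b : Site d → ℕ → Fin 2) (η : Config d)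
    (ξ : ℝ → Config d) : Prop where
  initial : ξ 0 = η
  update : ∀ x n, (∃ i, ξ (τ x n) (x - e i) = 0) → ξ (τ x n) x = b x n
  constant : ∀ x s t, 0 ≤ s → s ≤ t →
    (∀ n, s < τ x n → τ x n ≤ t → ¬ ∃ i, ξ (τ x n) (x - e i) = 0) → ξ t x = ξ s x

/-- `X` is the East dynamics on `ℤ^d` with parameter `p` started from the configuration `η`,
realized on the probability space `(Ω, P)`: it is driven almost surely by exponential clocks and
Bernoulli variables through the evolution rule. -/
def IsEastProcess {d : ℕ} {Ω : Type*} [MeasurableSpace Ω] (P : Measure Ω) (p : ℝ) (η : Config d)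
    (X : ℝ → Ω → Config d) : Prop :=
  ∃ (gap : Site d → ℕ → Ω → ℝ) (coin : Site d → ℕ → Ω → Fin 2),
    IsGraphicalConstruction P p gap coin ∧
    ∀ᵐ ω ∂P, IsEastPath (ringTime fun x n => gap x n ω) (fun x n => coin x n ω) η
      (fun t => X t ω)

/-- The total time that the site `x` spends at zero between time `0` and time `t`, along the
path `ξ`. -/
noncomputable def timeAtZero {d : ℕ} (ξ : ℝ → Config d) (t : ℝ) (x : Site d) : ℝ :=
  ∫ s in (0 : ℝ)..t, if ξ s x = 0 then 1 else 0

/-- The event that some site of `{-⌊2dαt⌋, …, 0}^d` spends a total time at least `(1-p)t/4` at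
zero between time `0` and time `t`. -/
def zeroEvent {d : ℕ} {Ω : Type*} (p α : ℝ) (X : ℝ → Ω → Config d) (t : ℝ) : Set Ω :=
  {ω | ∃ x ∈ box d (2 * d * α * t), (1 - p) / 4 * t ≤ timeAtZero (fun s => X s ω) t x}

/-! ### The dynamics exists

The helper facts below show that the evolution rule can be followed: almost surely there is no
infinite chain of neighbouring rings going back in time, so a path exists for every initial
configuration. -/

/-- If no infinite chain of rings goes back in time, a path exists. -/
theorem exists_path {d : ℕ} (τ : Site d → ℕ → ℝ) (b : Site d → ℕ → Fin 2) (η : Config d)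
    (hpos : ∀ x n, 0 < τ x n) (hmono : ∀ x, StrictMono (τ x))
    (hwf : WellFounded fun (k l : Site d × ℕ) =>
      (∃ i, k.1 = l.1 - e i) ∧ τ k.1 k.2 ≤ τ l.1 l.2) :
    ∃ ξ, IsEastPath τ b η ξ := by
  classical
  let spin : Site d → Set ℕ → Fin 2 := fun y S => if S.Nonempty then b y (sSup S) else η y
  let acc : Site d × ℕ → Prop := hwf.fix fun l ih => ∃ i, spin (l.1 - e i)
    {m | ∃ h : τ (l.1 - e i) m ≤ τ l.1 l.2, ih (l.1 - e i, m) ⟨⟨i, rfl⟩, h⟩} = 0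
  let ξ : ℝ → Config d := fun s y => spin y {m | τ y m ≤ s ∧ acc (y, m)}
  have hacc : ∀ x n, acc (x, n) ↔ ∃ i, ξ (τ x n) (x - e i) = 0 := by
    intro x n
    simp only [acc, ξ]
    rw [hwf.fix_eq]
    simp only [exists_prop]
  refine ⟨ξ, ?_, ?_, ?_⟩
  · funext y
    have : {m | τ y m ≤ 0 ∧ acc (y, m)} = ∅ := by
      ext m; simp [not_le.2 (hpos y m)]
    simp [ξ, spin, this]
  · intro x n h
    rw [← hacc] at h
    have hg : IsGreatest {m | τ x m ≤ τ x n ∧ acc (x, m)} n :=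
      ⟨⟨le_rfl, h⟩, fun m hm => (hmono x).le_iff_le.1 hm.1⟩
    simp only [ξ, spin]
    rw [if_pos ⟨n, hg.1⟩, hg.csSup_eq]
  · intro x s t _ hst h
    have : {m | τ x m ≤ t ∧ acc (x, m)} = {m | τ x m ≤ s ∧ acc (x, m)} := by
      ext m
      refine ⟨fun hm => ⟨?_, hm.2⟩, fun hm => ⟨hm.1.trans hst, hm.2⟩⟩
      by_contra hc
      exact h m (not_le.1 hc) hm.1 ((hacc x m).1 hm.2)
    simp only [ξ, this]

/-- There is no infinite chain of rings going back in time if there is none inside short time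
slabs. -/
theorem wf_of_slabs {d : ℕ} (τ : Site d → ℕ → ℝ) (hpos : ∀ x n, 0 < τ x n)
    (δ : ℕ → ℝ) (hδ : ∀ T, 0 < δ T)
    (h : ∀ (T k : ℕ), k * δ T ≤ T → ¬ ∃ f : ℕ → Site d, (∀ j, ∃ i, f (j + 1) = f j - e i) ∧
      ∀ j, ∃ n, k * δ T < τ (f j) n ∧ τ (f j) n ≤ k * δ T + δ T) :
    WellFounded fun (k l : Site d × ℕ) =>
      (∃ i, k.1 = l.1 - e i) ∧ τ k.1 k.2 ≤ τ l.1 l.2 := by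
  rw [wellFounded_iff_isEmpty_descending_chain]
  constructor
  rintro ⟨c, hc⟩
  have hanti : Antitone fun j => τ (c j).1 (c j).2 := antitone_nat_of_succ_le fun j => (hc j).2
  obtain ⟨T, hT⟩ := exists_nat_ge (τ (c 0).1 (c 0).2)
  let K : ℕ → ℕ := fun j => ⌈τ (c j).1 (c j).2 / δ T⌉₊
  have hK : Antitone K := fun a b hab =>
    Nat.ceil_mono (div_le_div_of_nonneg_right (hanti hab) (hδ T).le)
  obtain ⟨m, hm⟩ : ∃ m, ∀ j, K m ≤ K j := by
    obtain ⟨_, ⟨m, rfl⟩, hm⟩ := WellFounded.has_min (wellFounded_lt (α := ℕ)) (Set.range K)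
      ⟨_, 0, rfl⟩
    exact ⟨m, fun j => not_lt.1 (hm _ ⟨j, rfl⟩)⟩
  have hKpos : ∀ j, 0 < K j := fun j => Nat.ceil_pos.2 (div_pos (hpos _ _) (hδ T))
  obtain ⟨k, hk⟩ : ∃ k, K m = k + 1 := ⟨K m - 1, by have := hKpos m; omega⟩
  have hKj : ∀ j, K (m + j) = k + 1 := fun j =>
    hk ▸ le_antisymm (hK (Nat.le_add_right m j)) (hm _)
  have hlow : ∀ j, k * δ T < τ (c (m + j)).1 (c (m + j)).2 := by
    intro j
    have : k < ⌈τ (c (m + j)).1 (c (m + j)).2 / δ T⌉₊ := by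
      have := hKj j
      simp only [K] at this
      omega
    rw [Nat.lt_ceil] at this
    exact (lt_div_iff₀ (hδ T)).1 this
  refine h T k ?_ ⟨fun j => (c (m + j)).1, fun j => (hc (m + j)).1, fun j =>
    ⟨(c (m + j)).2, hlow j, ?_⟩⟩
  · exact (hlow 0).le.trans ((hanti (Nat.zero_le _)).trans hT)
  · have h1 : τ (c (m + j)).1 (c (m + j)).2 / δ T ≤ ((k + 1 : ℕ) : ℝ) := by
      rw [← hKj j]; exact Nat.le_ceil _
    rw [div_le_iff₀ (hδ T)] at h1
    push_cast at h1
    linarith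

/-- Sites that are open independently, each with probability at most `1/(2d)`, almost surely
contain no infinite oriented path. -/
theorem no_infinite_path {d : ℕ} {W : Type*} [MeasurableSpace W] (ν : Measure W)
    [IsProbabilityMeasure ν] (R : Set W) (hR : MeasurableSet R) (hq : d * ν R ≤ 2⁻¹)
    (x : Site d) :
    ∀ᵐ ω ∂(Measure.infinitePi fun _ : Site d => ν),
      ¬ ∃ f : ℕ → Site d, f 0 = x ∧ (∀ j, ∃ i, f (j + 1) = f j - e i) ∧ ∀ j, ω (f j) ∈ R := by
  classical
  set Q := Measure.infinitePi fun _ : Site d => ν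
  let y : ∀ m : ℕ, (Fin m → Fin d) → Fin m → Site d := fun m g j =>
    x - ∑ l : Fin m with l < j, e (g l)
  have hcoord : ∀ i : Fin d, ∑ a, (e i : Site d) a = 1 := by
    intro i; simp [e, Finset.sum_pi_single']
  have hy : ∀ m g, Function.Injective (y m g) := by
    intro m g j j' hjj
    have h1 : ∀ j, ∑ a, y m g j a = ∑ a, x a - (j : ℕ) := by
      intro j
      simp only [y, Pi.sub_apply, Finset.sum_apply, Finset.sum_sub_distrib]
      rw [Finset.sum_comm]
      simp only [hcoord]
      have : (Finset.univ.filter fun l : Fin m => l < j) = Finset.Iio j := by ext; simp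
      rw [Finset.sum_const, this, Fin.card_Iio]
      simp
    have h2 := h1 j
    rw [hjj, h1 j'] at h2
    apply Fin.ext; omega
  have hle : ∀ m : ℕ, Q {ω | ∃ f : ℕ → Site d, f 0 = x ∧ (∀ j, ∃ i, f (j + 1) = f j - e i) ∧
      ∀ j, ω (f j) ∈ R} ≤ (2⁻¹ : ENNReal) ^ m := by
    intro m
    calc _ ≤ Q (⋃ g : Fin m → Fin d,
          Set.pi (Finset.univ.image (y m g) : Finset (Site d)) fun _ => R) := by
          apply measure_mono
          rintro ω ⟨f, hf0, hf, hfR⟩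
          choose i hi using hf
          refine Set.mem_iUnion.2 ⟨fun j => i j, ?_⟩
          intro z hz
          simp only [Finset.coe_image, Finset.coe_univ, Set.image_univ, Set.mem_range] at hz
          obtain ⟨j, rfl⟩ := hz
          have key : ∀ j : ℕ, f j = x - ∑ l ∈ Finset.range j, e (i l) := by
            intro j
            induction j with
            | zero => simp [hf0]
            | succ n ih => rw [hi, ih, Finset.sum_range_succ]; abel
          have : y m (fun j => i j) j = f j := by
            rw [key]
            simp only [y]
            congr 1
            refine Finset.sum_bij (fun l _ => (l : ℕ)) ?_ ?_ ?_ ?_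
            · intro l hl; simpa using hl
            · intro a _ b _ h; exact Fin.ext h
            · intro b hb
              have hb' : b < j := by simpa using hb
              exact ⟨⟨b, hb'.trans j.2⟩, Finset.mem_filter.2 ⟨Finset.mem_univ _, hb'⟩, rfl⟩
            · intros; rfl
          rw [this]; exact hfR j
      _ ≤ ∑ g : Fin m → Fin d,
          Q (Set.pi (Finset.univ.image (y m g) : Finset (Site d)) fun _ => R) :=
          measure_iUnion_fintype_le _ _
      _ = ∑ g : Fin m → Fin d, ν R ^ m := by
          refine Finset.sum_congr rfl fun g _ => ?_
          rw [Measure.infinitePi_pi _ (fun _ _ => hR), Finset.prod_const,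
            Finset.card_image_of_injective _ (hy m g)]
          simp
      _ = (d * ν R) ^ m := by simp [mul_pow]
      _ ≤ _ := pow_le_pow_left' hq m
  rw [ae_iff]
  simp only [not_not]
  exact le_antisymm (ge_of_tendsto' (ENNReal.tendsto_pow_atTop_nhds_zero_of_lt_one
    (r := 2⁻¹) (ENNReal.inv_lt_one.2 (by norm_num))) hle) zero_le

/-- The Bernoulli law of parameter `p` on `{0, 1}`. -/
noncomputable def bern (p : ℝ) : Measure (Fin 2) :=
  ENNReal.ofReal p • Measure.dirac 1 + ENNReal.ofReal (1 - p) • Measure.dirac 0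

theorem isProb_bern {p : ℝ} (h0 : 0 < p) (h1 : p < 1) : IsProbabilityMeasure (bern p) := by
  constructor
  simp only [bern, Measure.add_apply, Measure.smul_apply, measure_univ, smul_eq_mul, mul_one]
  rw [← ENNReal.ofReal_add h0.le (by linarith), add_sub_cancel, ENNReal.ofReal_one]

theorem exp_Ioc_le (a b : ℝ) : expMeasure 1 (Set.Ioc a b) ≤ ENNReal.ofReal (b - a) := by
  have : expMeasure 1 = volume.withDensity (exponentialPDF 1) := rfl
  rw [this, withDensity_apply _ measurableSet_Ioc, ← Real.volume_Ioc]
  calc _ ≤ ∫⁻ _ in Set.Ioc a b, 1 := by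
        refine lintegral_mono fun x => ?_
        rw [exponentialPDF_eq]
        split_ifs with h
        · simp [h]
        · simp
    _ = _ := by simp

theorem exp_pos_ae : ∀ᵐ x ∂(expMeasure 1), 0 < x := by
  have : expMeasure 1 = volume.withDensity (exponentialPDF 1) := rfl
  rw [ae_iff]
  simp only [not_lt]
  change expMeasure 1 (Set.Iic 0) = 0
  rw [this, withDensity_apply _ measurableSet_Iic, ← setLIntegral_congr Iio_ae_eq_Iic]
  exact lintegral_exponentialPDF_of_nonpos le_rfl

theorem gap_pos_ae {Ω : Type*} [MeasurableSpace Ω] (P : Measure Ω)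
    (g : ℕ → Ω → ℝ) (hm : ∀ n, Measurable (g n)) (hlaw : ∀ n, P.map (g n) = expMeasure 1) : ∀ᵐ ω ∂P, ∀ n, 0 < g n ω := by
  rw [ae_all_iff]
  intro n
  have := exp_pos_ae
  rw [← hlaw n] at this
  exact ae_of_ae_map (hm n).aemeasurable this

theorem ring_slab_le {Ω : Type*} [MeasurableSpace Ω] (P : Measure Ω) [IsProbabilityMeasure P]
    (g : ℕ → Ω → ℝ) (hm : ∀ n, Measurable (g n)) (hlaw : ∀ n, P.map (g n) = expMeasure 1)
    (hind : iIndepFun g P) (n : ℕ) (a δ : ℝ) :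
    P {ω | a < ∑ k ∈ Finset.range (n + 1), g k ω ∧ ∑ k ∈ Finset.range (n + 1), g k ω ≤ a + δ}
      ≤ ENNReal.ofReal δ := by
  have hi : IndepFun (∑ k ∈ Finset.range n, g k) (g n) P :=
    hind.indepFun_finsetSum_of_notMem hm (by simp)
  have hms : Measurable (∑ k ∈ Finset.range n, g k) := by
        rw [show (∑ k ∈ _, g k) = fun ω => ∑ k ∈ _, g k ω from funext fun ω => Finset.sum_apply ..]
        exact Finset.measurable_sum _ fun k _ => hm k
  have := isProbabilityMeasure_expMeasure one_pos
  have := Measure.isProbabilityMeasure_map (μ := P) hms.aemeasurable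
  have hmap := (indepFun_iff_map_prod_eq_prod_map_map hms.aemeasurable (hm n).aemeasurable).1 hi
  rw [hlaw n] at hmap
  let A : Set (ℝ × ℝ) := (fun z => z.1 + z.2) ⁻¹' Set.Ioc a (a + δ)
  have hA : MeasurableSet A := measurableSet_Ioc.preimage (by fun_prop)
  have h1 : {ω | a < ∑ k ∈ Finset.range (n + 1), g k ω ∧
      ∑ k ∈ Finset.range (n + 1), g k ω ≤ a + δ} =
      (fun ω => ((∑ k ∈ Finset.range n, g k) ω, g n ω)) ⁻¹' A := by
    ext ω; simp [A, Finset.sum_range_succ, Finset.sum_apply]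
  rw [h1, ← Measure.map_apply (hms.prodMk (hm n)) hA, hmap, Measure.prod_apply hA]
  calc _ ≤ ∫⁻ _, ENNReal.ofReal δ ∂(P.map (∑ k ∈ Finset.range n, g k)) := by
        refine lintegral_mono fun u => ?_
        have : Prod.mk u ⁻¹' A = Set.Ioc (a - u) (a + δ - u) := by
          ext v; simp only [A, Set.mem_preimage, Set.mem_Ioc]
          constructor <;> rintro ⟨h, h'⟩ <;> constructor <;> linarith
        rw [this]
        refine (exp_Ioc_le _ _).trans (le_of_eq ?_)
        congr 1; ring
    _ = _ := by simp

theorem ring_tail {Ω : Type*} [MeasurableSpace Ω] (P : Measure Ω) [IsProbabilityMeasure P]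
    (g : ℕ → Ω → ℝ) (hm : ∀ n, Measurable (g n)) (hlaw : ∀ n, P.map (g n) = expMeasure 1)
    (hind : iIndepFun g P) (T : ℝ) :
    Filter.Tendsto (fun n => P {ω | ∑ k ∈ Finset.range (n + 1), g k ω ≤ T}) Filter.atTop
      (nhds 0) := by
  set r := mgf (g 0) P (-1)
  have hmgf : ∀ n, mgf (g n) P (-1) = ∫ x, Real.exp (-1 * x) ∂(expMeasure 1) := by
    intro n
    rw [← hlaw n, integral_map (hm n).aemeasurable (by fun_prop)]
    rfl
  have hr : ∀ n, mgf (g n) P (-1) = r := fun n => (hmgf n).trans (hmgf 0).symm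
  have hint : ∀ X : Ω → ℝ, Measurable X → (∀ᵐ ω ∂P, 0 ≤ X ω) →
      Integrable (fun ω => Real.exp (-1 * X ω)) P := by
    intro X hX h
    refine Integrable.of_bound (by fun_prop) 1 ?_
    filter_upwards [h] with ω hω
    rw [Real.norm_eq_abs, abs_of_pos (Real.exp_pos _)]
    exact Real.exp_le_one_iff.2 (by linarith)
  have hpos := gap_pos_ae P g hm hlaw
  have hr0 : 0 ≤ r := mgf_nonneg
  have hr1 : r < 1 := by
    have h0 : ∀ᵐ ω ∂P, 0 < g 0 ω := by filter_upwards [hpos] with ω h using h 0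
    have hi := hint (g 0) (hm 0) (by filter_upwards [h0] with ω h using h.le)
    have : 0 < ∫ ω, (1 - Real.exp (-1 * g 0 ω)) ∂P := by
      rw [integral_pos_iff_support_of_nonneg_ae (f := fun ω => 1 - Real.exp (-1 * g 0 ω)) _
        ((integrable_const 1).sub hi)]
      · have : (Function.support fun ω => 1 - Real.exp (-1 * g 0 ω)) =ᵐ[P] Set.univ := by
          filter_upwards [h0] with ω h
          apply propext
          refine ⟨fun _ => trivial, fun _ => ?_⟩
          have : Real.exp (-1 * g 0 ω) < 1 := Real.exp_lt_one_iff.2 (by linarith)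
          exact ne_of_gt (sub_pos.2 this)
        rw [measure_congr this]; simp
      · filter_upwards [h0] with ω h
        have : Real.exp (-1 * g 0 ω) < 1 := Real.exp_lt_one_iff.2 (by linarith)
        simpa using this.le
    rw [integral_sub (integrable_const 1) hi] at this
    simp only [integral_const, smul_eq_mul, mul_one, probReal_univ] at this
    change 0 < 1 - r at this
    linarith
  have hb : ∀ n : ℕ, P {ω | ∑ k ∈ Finset.range (n + 1), g k ω ≤ T}
      ≤ ENNReal.ofReal (Real.exp T * r ^ (n + 1)) := by
    intro n
    have hms : Measurable (∑ k ∈ Finset.range (n + 1), g k) := by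
        rw [show (∑ k ∈ _, g k) = fun ω => ∑ k ∈ _, g k ω from funext fun ω => Finset.sum_apply ..]
        exact Finset.measurable_sum _ fun k _ => hm k
    have := measure_le_le_exp_mul_mgf (μ := P) (X := ∑ k ∈ Finset.range (n + 1), g k) (t := -1) T
      (by norm_num) (hint _ hms (by
        filter_upwards [hpos] with ω h
        rw [Finset.sum_apply]
        exact Finset.sum_nonneg fun k _ => (h k).le))
    rw [hind.mgf_sum hm] at this
    simp only [hr, Finset.prod_const, Finset.card_range, neg_neg, one_mul,
      Finset.sum_apply] at this
    rw [← ENNReal.ofReal_toReal (measure_ne_top P _)]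
    exact ENNReal.ofReal_le_ofReal this
  refine tendsto_of_tendsto_of_tendsto_of_le_of_le tendsto_const_nhds ?_ (fun _ => zero_le) hb
  rw [← ENNReal.ofReal_zero]
  refine ENNReal.tendsto_ofReal ?_
  have := ((tendsto_pow_atTop_nhds_zero_of_lt_one hr0 hr1).comp
    (Filter.tendsto_add_atTop_nat 1)).const_mul (Real.exp T)
  simpa using this

theorem slab_small {Ω : Type*} [MeasurableSpace Ω] (P : Measure Ω) [IsProbabilityMeasure P]
    (g : ℕ → Ω → ℝ) (hm : ∀ n, Measurable (g n)) (hlaw : ∀ n, P.map (g n) = expMeasure 1)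
    (hind : iIndepFun g P) (T : ℝ) (ε : ENNReal) (hε : 0 < ε) : ∃ δ : ℝ, 0 < δ ∧ ∀ a ≤ T,
    P {ω | ∃ n, a < ∑ k ∈ Finset.range (n + 1), g k ω ∧
      ∑ k ∈ Finset.range (n + 1), g k ω ≤ a + δ} ≤ ε := by
  have hε2 : 0 < ε / 2 := ENNReal.half_pos hε.ne'
  obtain ⟨N, hN⟩ := ((ring_tail P g hm hlaw hind (T + 1)).eventually_le_const hε2).exists
  obtain ⟨δ, hδ0, hδ1, hδ⟩ : ∃ δ : ℝ, 0 < δ ∧ δ ≤ 1 ∧ N * ENNReal.ofReal δ ≤ ε / 2 := by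
    have h1 : Filter.Tendsto (fun δ : ℝ => N * ENNReal.ofReal δ) (nhdsWithin 0 (Set.Ioi 0))
        (nhds 0) := by
      have h2 : Filter.Tendsto (fun δ : ℝ => N * ENNReal.ofReal δ) (nhds 0)
          (nhds (N * ENNReal.ofReal 0)) :=
        ENNReal.Tendsto.const_mul (ENNReal.tendsto_ofReal Filter.tendsto_id)
          (Or.inr (ENNReal.natCast_ne_top N))
      simp only [ENNReal.ofReal_zero, mul_zero] at h2
      exact h2.mono_left nhdsWithin_le_nhds
    obtain ⟨δ, h2, h3⟩ := ((h1.eventually_le_const hε2).and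
      (Ioc_mem_nhdsGT (one_pos : (0 : ℝ) < 1))).exists
    exact ⟨δ, h3.1, h3.2, h2⟩
  refine ⟨δ, hδ0, fun a ha => ?_⟩
  calc _ ≤ P ((⋃ n ∈ Finset.range N, {ω | a < ∑ k ∈ Finset.range (n + 1), g k ω ∧
          ∑ k ∈ Finset.range (n + 1), g k ω ≤ a + δ}) ∪
          {ω | ∑ k ∈ Finset.range (N + 1), g k ω ≤ T + 1}) := by
        apply measure_mono_ae
        filter_upwards [gap_pos_ae P g hm hlaw] with ω hω
        rintro ⟨n, h1, h2⟩
        rcases lt_or_ge n N with h | h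
        · exact Or.inl (Set.mem_biUnion (Finset.mem_coe.2 (Finset.mem_range.2 h)) ⟨h1, h2⟩)
        · right
          have : ∑ k ∈ Finset.range (N + 1), g k ω ≤ ∑ k ∈ Finset.range (n + 1), g k ω :=
            Finset.sum_le_sum_of_subset_of_nonneg
              (Finset.range_mono (by omega)) fun k _ _ => (hω k).le
          change ∑ k ∈ Finset.range (N + 1), g k ω ≤ T + 1
          linarith
    _ ≤ ∑ n ∈ Finset.range N, ENNReal.ofReal δ + ε / 2 := by
        refine (measure_union_le _ _).trans (add_le_add ?_ hN)
        exact (measure_biUnion_finset_le _ _).trans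
          (Finset.sum_le_sum fun n _ => ring_slab_le P g hm hlaw hind n a δ)
    _ ≤ ε / 2 + ε / 2 := by
        gcongr
        simpa using hδ
    _ = ε := ENNReal.add_halves ε

/-- The East dynamics exists: for every initial configuration it is realized on some probability
space. -/
theorem exists_isEastProcess (d : ℕ) (p : ℝ) (hp0 : 0 < p) (hp1 : p < 1) (η : Config d) :
    ∃ (Ω : Type) (_ : MeasurableSpace Ω) (P : Measure Ω) (_ : IsProbabilityMeasure P)
      (X : ℝ → Ω → Config d), IsEastProcess P p η X := by
  classical
  have := isProbabilityMeasure_expMeasure one_pos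
  have := isProb_bern hp0 hp1
  let μ₀ : Measure (ℝ × Fin 2) := (expMeasure 1).prod (bern p)
  let ν : Measure (ℕ → ℝ × Fin 2) := Measure.infinitePi fun _ => μ₀
  let P : Measure (Site d → ℕ → ℝ × Fin 2) := Measure.infinitePi fun _ => ν
  let gap : Site d → ℕ → (Site d → ℕ → ℝ × Fin 2) → ℝ := fun x n ω => (ω x n).1
  let coin : Site d → ℕ → (Site d → ℕ → ℝ × Fin 2) → Fin 2 := fun x n ω => (ω x n).2
  have hνeval : ∀ n, ν.map (fun w => w n) = μ₀ := fun n => Measure.infinitePi_map_eval _ n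
  have hPx : ∀ x, P.map (fun ω => ω x) = ν := fun x => Measure.infinitePi_map_eval _ x
  have hPeval : ∀ x n, P.map (fun ω => ω x n) = μ₀ := by
    intro x n
    rw [← hνeval n, ← hPx x, Measure.map_map (by fun_prop) (by fun_prop)]
    rfl
  let g : ℕ → (ℕ → ℝ × Fin 2) → ℝ := fun n w => (w n).1
  have hgm : ∀ n, Measurable (g n) := fun n => by fun_prop
  have hglaw : ∀ n, ν.map (g n) = expMeasure 1 := by
    intro n
    have : g n = Prod.fst ∘ fun w => w n := rfl
    rw [this, ← Measure.map_map (by fun_prop) (by fun_prop), hνeval]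
    simp [μ₀]
  have hgind : iIndepFun g ν :=
    iIndepFun_infinitePi (X := fun _ (z : ℝ × Fin 2) => z.1) (fun _ => measurable_fst)
  have hgap_law : ∀ x n, P.map (gap x n) = expMeasure 1 := by
    intro x n
    have : gap x n = g n ∘ fun ω => ω x := rfl
    rw [this, ← Measure.map_map (hgm n) (by fun_prop), hPx, hglaw]
  have hcoin_law : ∀ x n, P.map (coin x n) = bern p := by
    intro x n
    have : coin x n = Prod.snd ∘ fun ω => ω x n := rfl
    rw [this, ← Measure.map_map (by fun_prop) (by fun_prop), hPeval]
    simp [μ₀]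
  have hG : IsGraphicalConstruction P p gap coin := by
    refine ⟨fun x n => by fun_prop, fun x n => by fun_prop, hgap_law, fun x n => ?_, ?_, ?_⟩
    · have : {ω | coin x n ω = 1} = coin x n ⁻¹' {1} := rfl
      rw [this, ← Measure.map_apply (by fun_prop) (by simp), hcoin_law]
      simp [bern]
    · exact iIndepFun_uncurry_infinitePi' (fun (_ : Site d) (_ : ℕ) => μ₀)
        (X := fun _ _ (z : ℝ × Fin 2) => (z.1, z.2)) (fun _ _ => by fun_prop)
    · intro x n
      rw [indepFun_iff_map_prod_eq_prod_map_map (by fun_prop) (by fun_prop), hgap_law, hcoin_law]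
      exact hPeval x n
  obtain ⟨ε, hε0, hε⟩ : ∃ ε : ENNReal, 0 < ε ∧ d * ε ≤ 2⁻¹ := by
    refine ⟨2⁻¹ / (d + 1 : ℕ), by simp [ENNReal.div_pos_iff], ?_⟩
    rw [← mul_div_assoc, mul_comm, mul_div_assoc]
    refine mul_le_of_le_one_right' ?_
    exact ENNReal.div_le_of_le_mul (by rw [one_mul]; exact_mod_cast Nat.le_succ d)
  choose δ hδ0 hδ using fun T : ℕ => slab_small ν g hgm hglaw hgind T ε hε0
  let R : ℕ → ℕ → Set (ℕ → ℝ × Fin 2) := fun T k =>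
    {w | ∃ n, k * δ T < ∑ l ∈ Finset.range (n + 1), g l w ∧
      ∑ l ∈ Finset.range (n + 1), g l w ≤ k * δ T + δ T}
  have hR : ∀ T k, MeasurableSet (R T k) := by
    intro T k
    have : R T k = ⋃ n, (fun w => ∑ l ∈ Finset.range (n + 1), g l w) ⁻¹'
        Set.Ioc (k * δ T) (k * δ T + δ T) := by
      ext w; simp [R]
    rw [this]
    exact MeasurableSet.iUnion fun n => measurableSet_Ioc.preimage (by fun_prop)
  have hslab : ∀ᵐ ω ∂P, ∀ (T k : ℕ), k * δ T ≤ T → ∀ x : Site d,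
      ¬ ∃ f : ℕ → Site d, f 0 = x ∧ (∀ j, ∃ i, f (j + 1) = f j - e i) ∧
        ∀ j, ω (f j) ∈ R T k := by
    simp only [ae_all_iff]
    intro T k hk x
    exact no_infinite_path ν (R T k) (hR T k)
      ((mul_le_mul_right (hδ T _ hk) _).trans hε) x
  have hgpos : ∀ᵐ ω ∂P, ∀ x n, 0 < gap x n ω := by
    rw [ae_all_iff]
    intro x
    exact gap_pos_ae P (gap x) (fun n => by fun_prop) (hgap_law x)
  have hex : ∀ᵐ ω ∂P, ∃ ξ, IsEastPath (ringTime fun x n => gap x n ω) (fun x n => coin x n ω)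
      η ξ := by
    filter_upwards [hslab, hgpos] with ω h1 h2
    have hpos : ∀ x n, 0 < ringTime (fun x n => gap x n ω) x n := fun x n =>
      Finset.sum_pos (fun k _ => h2 x k) ⟨0, by simp⟩
    refine exists_path _ _ _ hpos (fun x => ?_) (wf_of_slabs _ hpos δ hδ0 ?_)
    · refine strictMono_nat_of_lt_succ fun n => ?_
      simp only [ringTime]
      rw [Finset.sum_range_succ _ (n + 1)]
      linarith [h2 x (n + 1)]
    · rintro T k hk ⟨f, hf, hf'⟩
      exact h1 T k hk (f 0) ⟨f, rfl, hf, hf'⟩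
  refine ⟨_, _, P, inferInstance, fun t ω => if h : ∃ ξ, IsEastPath (ringTime fun x n => gap x n ω)
    (fun x n => coin x n ω) η ξ then h.choose t else η, gap, coin, hG, ?_⟩
  filter_upwards [hex] with ω h
  simp only [h, dite_true]
  exact h.choose_spec

end EastModel

/-!
The level of a site is the sum of its coordinates; the constraint at a site involves only sites of
the level just below. Put `a = (1 - p) / 4 * t` and call a site good if it starts from zero or has
an accepted ring up to time `a`.

A good site that spends less than the time `a` at zero must have an accepted ring up to time `a`
(otherwise it would stay at zero during `[0, a]`), hence a neighbour of the level below that is at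
zero at this time, and this neighbour is good in turn (`IsEastPath.exists_good_neighbour`). So if
every site of the large box spends less than the time `a` at zero, then, starting from the given
initial zero, there is a good site at each of the next `⌊α t⌋` levels, and the chain of these sites
has no room to leave the box (`IsEastPath.exists_good_chain`).

Whether a site is good depends neither on its own coins nor on the coins at the other sites of its
level or above. Given all other randomness, the spin at a good site is zero with probability at
least `1 - p` at each time after `a`, so that its expected time at zero is at least
`(1 - p) * (t - a)`, and by Markov's inequality the site spends less than `a` at zero with
conditional probability at most `(1 + p) / 2` (`zeroTime_lt_le`). Treating the levels from the
lowest to the highest, the probability that each of `n` levels contains a good site and no site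
spends the time `a` at zero is at most `((1 + p) / 2) ^ n` (`measure_failSet_levels_le`). There is
no union bound over chains: only the existence of a good site at each level is used.

For the conditioning to make sense the dynamics has to be a measurable function of the clocks and
the coins. Almost surely the Picard iterates of the evolution rule stabilize to the path
(`IsEastPath.eventually_picard_iff`), because no infinite chain of rings goes back in time
(`ae_regularTimes`), and they are jointly measurable. Conditioning on everything but the coins of
one site is expressed by replacing these coins by independent copies, which preserves the law
(`map_resample`).
-/

namespace EastModel

/-! ### The dynamics as a measurable function of the clocks and the coins -/

/-- The spin of a site is zero at time `s`, for a site with ring times `τ`, coins `b`, and initial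
spin zero exactly if `z` holds, when the rings accepted are those at the times at which `V` holds:
the last accepted ring up to time `s`, if there is one, has coin zero, and `z` holds if there is
no accepted ring. (If infinitely many rings are accepted up to time `s`, this holds vacuously.) -/
def LastUpdateZero (τ : ℕ → ℝ) (b : ℕ → Fin 2) (z : Prop) (V : ℝ → Prop) (s : ℝ) : Prop :=
  (∀ m, τ m ≤ s → V (τ m) → (∀ n, m < n → τ n ≤ s → ¬ V (τ n)) → b m = 0) ∧
    ((∀ m, τ m ≤ s → ¬ V (τ m)) → z)

/-- The Picard iterates of the evolution rule: at stage `0` the configuration is frozen, and at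
stage `k + 1` the rings are accepted according to stage `k`. The proposition says that the spin at
`x` is zero at time `s`. -/
def PicardZero {d : ℕ} (τ : Site d → ℕ → ℝ) (c : Site d × ℕ → Fin 2) (η : Config d) :
    ℕ → ℝ → Site d → Prop
  | 0, _, x => η x = 0
  | k + 1, s, x => LastUpdateZero (τ x) (fun n => c (x, n)) (η x = 0)
      (fun u => ∃ i, PicardZero τ c η k u (x - e i)) s

/-- The constraint at `x` is satisfied at time `u`, in the limit of the Picard iterates. -/
def Enabled {d : ℕ} (τ : Site d → ℕ → ℝ) (c : Site d × ℕ → Fin 2) (η : Config d) (x : Site d)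
    (u : ℝ) : Prop :=
  ∃ i, ∀ᶠ k in Filter.atTop, PicardZero τ c η k u (x - e i)

/-- The spin at `x` is zero at time `s`, in the limit of the Picard iterates. -/
def ZeroAt {d : ℕ} (τ : Site d → ℕ → ℝ) (c : Site d × ℕ → Fin 2) (η : Config d) (x : Site d)
    (s : ℝ) : Prop :=
  LastUpdateZero (τ x) (fun n => c (x, n)) (η x = 0) (Enabled τ c η x) s

/-- The site `x` starts from zero or has an accepted ring up to time `a`. This does not involve
the coins at `x`. -/
def Good {d : ℕ} (τ : Site d → ℕ → ℝ) (c : Site d × ℕ → Fin 2) (η : Config d) (a : ℝ)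
    (x : Site d) : Prop :=
  η x = 0 ∨ ∃ m, τ x m ≤ a ∧ Enabled τ c η x (τ x m)

theorem lastUpdateZero_congr {τ : ℕ → ℝ} {b : ℕ → Fin 2} {z : Prop} {V W : ℝ → Prop} {s : ℝ}
    (h : ∀ m, τ m ≤ s → (V (τ m) ↔ W (τ m))) :
    LastUpdateZero τ b z V s ↔ LastUpdateZero τ b z W s := by
  unfold LastUpdateZero
  have h1 : ∀ m, (τ m ≤ s → ¬ V (τ m)) ↔ (τ m ≤ s → ¬ W (τ m)) := fun m =>
    forall_congr' fun hm => not_congr (h m hm)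
  refine and_congr (forall_congr' fun m => forall_congr' fun hm => ?_)
    (by simp only [h1])
  simp only [h m hm, h1]

theorem IsEastPath.zero_iff {d : ℕ} {τ : Site d → ℕ → ℝ} {b : Site d → ℕ → Fin 2} {η : Config d}
    {ξ : ℝ → Config d} (hξ : IsEastPath τ b η ξ) {x : Site d} {s : ℝ} (hpos : ∀ n, 0 < τ x n)
    (hmono : StrictMono (τ x)) (hfin : {m | τ x m ≤ s}.Finite) (hs : 0 ≤ s) :
    ξ s x = 0 ↔ LastUpdateZero (τ x) (b x) (η x = 0) (fun u => ∃ i, ξ u (x - e i) = 0) s := by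
  set S := {m | τ x m ≤ s ∧ ∃ i, ξ (τ x m) (x - e i) = 0} with hS
  rcases S.eq_empty_or_nonempty with h | h
  · have h0 : ∀ m, τ x m ≤ s → ¬ ∃ i, ξ (τ x m) (x - e i) = 0 := fun m h1 h2 => by
      have : m ∈ S := ⟨h1, h2⟩
      rwa [h] at this
    have h1 : ξ s x = η x := by
      rw [hξ.constant x 0 s le_rfl hs fun n _ h2 => h0 n h2, hξ.initial]
    rw [h1]
    exact ⟨fun hz => ⟨fun m h1 h2 => absurd h2 (h0 m h1), fun _ => hz⟩, fun hz => hz.2 h0⟩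
  · have hSf : S.Finite := hfin.subset fun m hm => hm.1
    obtain ⟨m, hm, hmax⟩ := hSf.exists_maximal h
    have hlast : ∀ n, m < n → τ x n ≤ s → ¬ ∃ i, ξ (τ x n) (x - e i) = 0 := fun n hn h1 h2 =>
      absurd (hmax (y := n) ⟨h1, h2⟩ hn.le) (not_le.2 hn)
    have h1 : ξ s x = b x m := by
      rw [hξ.constant x (τ x m) s (hpos m).le hm.1
        fun n h1 h2 => hlast n (hmono.lt_iff_lt.1 h1) h2, hξ.update x m hm.2]
    rw [h1]
    refine ⟨fun hz => ⟨fun n hn hn' hn2 => ?_, fun h0 => absurd hm.2 (h0 m hm.1)⟩,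
      fun hz => hz.1 m hm.1 hm.2 hlast⟩
    have : n = m := by
      rcases lt_trichotomy n m with hl | hl | hl
      · exact absurd hm.2 (hn2 m hl hm.1)
      · exact hl
      · exact absurd hn' (hlast n hl hn)
    rwa [this]

/-- What is required of the ring times for the evolution rule to determine the path. -/
structure RegularTimes {d : ℕ} (τ : Site d → ℕ → ℝ) : Prop where
  pos : ∀ x n, 0 < τ x n
  strictMono : ∀ x, StrictMono (τ x)
  finite : ∀ x s, {m | τ x m ≤ s}.Finite
  wf : WellFounded fun (k l : Site d × ℕ) =>
      (∃ i, k.1 = l.1 - e i) ∧ τ k.1 k.2 ≤ τ l.1 l.2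

/-- The Picard iterates converge to the path, at
every site and time after finitely many steps. -/
theorem IsEastPath.eventually_picard_iff {d : ℕ} {τ : Site d → ℕ → ℝ} {c : Site d × ℕ → Fin 2}
    {η : Config d} {ξ : ℝ → Config d} (hξ : IsEastPath τ (fun x n => c (x, n)) η ξ)
    (hτ : RegularTimes τ) (x : Site d) {s : ℝ} (hs : 0 ≤ s) :
    ∀ᶠ k in Filter.atTop, (PicardZero τ c η k s x ↔ ξ s x = 0) := by
  have step : ∀ x s, 0 ≤ s →
      (∀ m, τ x m ≤ s → ∀ᶠ k in Filter.atTop,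
        ((∃ i, PicardZero τ c η k (τ x m) (x - e i)) ↔ ∃ i, ξ (τ x m) (x - e i) = 0)) →
      ∀ᶠ k in Filter.atTop, (PicardZero τ c η k s x ↔ ξ s x = 0) := by
    intro x s hs h
    have h1 := ((hτ.finite x s).eventually_all (l := Filter.atTop)
      (p := fun m k => ((∃ i, PicardZero τ c η k (τ x m) (x - e i)) ↔
        ∃ i, ξ (τ x m) (x - e i) = 0))).2 h
    rw [← Filter.map_add_atTop_eq_nat 1, Filter.eventually_map]
    filter_upwards [h1] with k hk
    rw [hξ.zero_iff (hτ.pos x) (hτ.strictMono x) (hτ.finite x s) hs, PicardZero]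
    exact lastUpdateZero_congr hk
  have hacc : ∀ l : Site d × ℕ, ∀ᶠ k in Filter.atTop,
      ((∃ i, PicardZero τ c η k (τ l.1 l.2) (l.1 - e i)) ↔
        ∃ i, ξ (τ l.1 l.2) (l.1 - e i) = 0) := by
    intro l
    induction l using hτ.wf.induction with
    | _ l ih =>
      have : ∀ᶠ k in Filter.atTop, ∀ i, (PicardZero τ c η k (τ l.1 l.2) (l.1 - e i) ↔
          ξ (τ l.1 l.2) (l.1 - e i) = 0) :=
        Filter.eventually_all.2 fun i => step _ _ (hτ.pos _ _).le fun m hm =>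
          ih (l.1 - e i, m) ⟨⟨i, rfl⟩, hm⟩
      filter_upwards [this] with k hk
      exact exists_congr hk
  exact step x s hs fun m _ => hacc (x, m)

theorem IsEastPath.enabled_iff {d : ℕ} {τ : Site d → ℕ → ℝ} {c : Site d × ℕ → Fin 2}
    {η : Config d} {ξ : ℝ → Config d} (hξ : IsEastPath τ (fun x n => c (x, n)) η ξ)
    (hτ : RegularTimes τ) (x : Site d) {s : ℝ} (hs : 0 ≤ s) :
    Enabled τ c η x s ↔ ∃ i, ξ s (x - e i) = 0 := by
  refine exists_congr fun i => ?_
  rw [Filter.eventually_congr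
    (hξ.eventually_picard_iff hτ (x - e i) hs),
    Filter.eventually_const]

theorem IsEastPath.zeroAt_iff {d : ℕ} {τ : Site d → ℕ → ℝ} {c : Site d × ℕ → Fin 2}
    {η : Config d} {ξ : ℝ → Config d} (hξ : IsEastPath τ (fun x n => c (x, n)) η ξ)
    (hτ : RegularTimes τ) (x : Site d) {s : ℝ} (hs : 0 ≤ s) :
    ZeroAt τ c η x s ↔ ξ s x = 0 := by
  rw [hξ.zero_iff (hτ.pos x) (hτ.strictMono x) (hτ.finite x s) hs, ZeroAt]
  exact lastUpdateZero_congr fun m _ => hξ.enabled_iff hτ x (hτ.pos x m).le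

/-! ### Measurability -/

theorem measurable_lastUpdateZero {Y : Type*} [MeasurableSpace Y] {τ : Y → ℕ → ℝ}
    {b : Y → ℕ → Fin 2} (z : Prop) {V : ℝ → Y → Prop} {s : Y → ℝ}
    (hτ : ∀ n, Measurable fun y => τ y n) (hb : ∀ n, Measurable fun y => b y n)
    (hV : ∀ n, Measurable fun y => V (τ y n) y) (hs : Measurable s) :
    Measurable fun y => LastUpdateZero (τ y) (b y) z (fun u => V u y) (s y) := by
  have hle : ∀ n, Measurable fun y => τ y n ≤ s y := fun n =>
    measurableSet_setOfPred.1 (measurableSet_le (hτ n) hs)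
  have hb0 : ∀ n, Measurable fun y => b y n = 0 := fun n =>
    measurableSet_setOfPred.1 (measurableSet_eq_fun (hb n) measurable_const)
  refine Measurable.and
    (Measurable.forall fun m => (hle m).imp ((hV m).imp (Measurable.imp ?_ (hb0 m))))
    (Measurable.imp ?_ measurable_const)
  · exact Measurable.forall fun n => measurable_const.imp ((hle n).imp (hV n).not)
  · exact Measurable.forall fun n => (hle n).imp (hV n).not

theorem measurable_ringTime {d : ℕ} (x : Site d) (n : ℕ) :
    Measurable fun g : Site d → ℕ → ℝ => ringTime g x n :=
  Finset.measurable_sum _ fun k _ => by fun_prop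

theorem measurable_picardZero {d : ℕ} (η : Config d) (k : ℕ) (x : Site d) :
    Measurable fun q : ℝ × (Site d → ℕ → ℝ) × (Site d × ℕ → Fin 2) =>
      PicardZero (ringTime q.2.1) q.2.2 η k q.1 x := by
  induction k generalizing x with
  | zero => exact measurable_const
  | succ k ih =>
    simp only [PicardZero]
    have hτ : ∀ n, Measurable fun q : ℝ × (Site d → ℕ → ℝ) × (Site d × ℕ → Fin 2) =>
        ringTime q.2.1 x n := fun n => (measurable_ringTime x n).comp (by fun_prop)
    refine measurable_lastUpdateZero (Y := ℝ × (Site d → ℕ → ℝ) × (Site d × ℕ → Fin 2)) _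
      (τ := fun q => ringTime q.2.1 x)
      (b := fun q n => q.2.2 (x, n))
      (V := fun u q => ∃ i, PicardZero (ringTime q.2.1) q.2.2 η k u (x - e i)) hτ
      (fun n => by fun_prop) (fun n => Measurable.exists fun i => ?_) measurable_fst
    exact (ih (x - e i)).comp ((hτ n).prodMk measurable_snd)

theorem measurable_enabled {d : ℕ} (η : Config d) (x : Site d) :
    Measurable fun q : ℝ × (Site d → ℕ → ℝ) × (Site d × ℕ → Fin 2) =>
      Enabled (ringTime q.2.1) q.2.2 η x q.1 := by
  simp only [Enabled, Filter.eventually_atTop]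
  exact Measurable.exists fun i => Measurable.exists fun K => Measurable.forall fun k =>
    measurable_const.imp (measurable_picardZero η k _)

theorem measurable_enabled_ringTime {d : ℕ} (η : Config d) (x : Site d) (n : ℕ) :
    Measurable fun w : (Site d → ℕ → ℝ) × (Site d × ℕ → Fin 2) =>
      Enabled (ringTime w.1) w.2 η x (ringTime w.1 x n) :=
  (measurable_enabled η x).comp
    (((measurable_ringTime x n).comp measurable_fst).prodMk measurable_id)

theorem measurable_zeroAt {d : ℕ} (η : Config d) (x : Site d) :
    Measurable fun q : ℝ × (Site d → ℕ → ℝ) × (Site d × ℕ → Fin 2) =>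
      ZeroAt (ringTime q.2.1) q.2.2 η x q.1 :=
  measurable_lastUpdateZero (Y := ℝ × (Site d → ℕ → ℝ) × (Site d × ℕ → Fin 2)) _
      (τ := fun q => ringTime q.2.1 x) (b := fun q n => q.2.2 (x, n))
    (V := fun u q => Enabled (ringTime q.2.1) q.2.2 η x u)
    (fun n => (measurable_ringTime x n).comp (by fun_prop))
    (fun n => by fun_prop) (fun n => (measurable_enabled_ringTime η x n).comp measurable_snd)
    measurable_fst

theorem measurable_good {d : ℕ} (η : Config d) (a : ℝ) (x : Site d) :
    Measurable fun w : (Site d → ℕ → ℝ) × (Site d × ℕ → Fin 2) =>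
      Good (ringTime w.1) w.2 η a x := by
  refine Measurable.or measurable_const (Measurable.exists fun m => Measurable.and ?_
    (measurable_enabled_ringTime η x m))
  exact measurableSet_setOfPred.1 (measurableSet_le ((measurable_ringTime x m).comp measurable_fst)
    measurable_const)

/-! ### Resampling the coins of one site -/

/-- The sum of the coordinates of a site. The spin at a site is influenced only by sites of lower
level, whence sites of the same level do not influence each other. -/
def level {d : ℕ} (x : Site d) : ℤ := ∑ i, x i

/-- The coins `c`, with those at the site `x` replaced by the ones of `c'`. -/
def resample {d : ℕ} (x : Site d) (c c' : Site d × ℕ → Fin 2) : Site d × ℕ → Fin 2 :=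
  fun k => if k.1 = x then c' k else c k

/-- The law of independent Bernoulli coins at every site. -/
noncomputable def coinLaw (d : ℕ) (p : ℝ) : Measure (Site d × ℕ → Fin 2) :=
  Measure.infinitePi fun _ => bern p

theorem level_sub_e {d : ℕ} (x : Site d) (i : Fin d) : level (x - e i) = level x - 1 := by
  simp [level, e, Finset.sum_sub_distrib, Finset.sum_pi_single']

theorem picardZero_resample {d : ℕ} (τ : Site d → ℕ → ℝ) (c c' : Site d × ℕ → Fin 2)
    (η : Config d) (x : Site d) (k : ℕ) (s : ℝ) {y : Site d} (h : level y < level x) :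
    PicardZero τ (resample x c c') η k s y ↔ PicardZero τ c η k s y := by
  induction k generalizing y s with
  | zero => rfl
  | succ k ih =>
    have hne : y ≠ x := fun h' => h.ne (congrArg level h')
    have h1 : (fun n => resample x c c' (y, n)) = fun n => c (y, n) := by
      funext n; simp [resample, hne]
    have h2 : ∀ u i, PicardZero τ (resample x c c') η k u (y - e i) ↔
        PicardZero τ c η k u (y - e i) := fun u i => ih u (by rw [level_sub_e]; omega)
    simp only [PicardZero, h1, h2]

theorem enabled_resample {d : ℕ} (τ : Site d → ℕ → ℝ) (c c' : Site d × ℕ → Fin 2)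
    (η : Config d) (x : Site d) (s : ℝ) {y : Site d} (h : level y ≤ level x) :
    Enabled τ (resample x c c') η y s ↔ Enabled τ c η y s := by
  unfold Enabled
  refine exists_congr fun i => Filter.eventually_congr (Filter.Eventually.of_forall fun k => ?_)
  exact picardZero_resample τ c c' η x k s (by rw [level_sub_e]; omega)

theorem good_resample {d : ℕ} (τ : Site d → ℕ → ℝ) (c c' : Site d × ℕ → Fin 2)
    (η : Config d) (a : ℝ) (x : Site d) {y : Site d} (h : level y ≤ level x) :
    Good τ (resample x c c') η a y ↔ Good τ c η a y := by
  simp only [Good, enabled_resample τ c c' η x _ h]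

theorem zeroAt_resample_of_lt {d : ℕ} (τ : Site d → ℕ → ℝ) (c c' : Site d × ℕ → Fin 2)
    (η : Config d) (x : Site d) (s : ℝ) {y : Site d} (h : level y < level x) :
    ZeroAt τ (resample x c c') η y s ↔ ZeroAt τ c η y s := by
  have hne : y ≠ x := fun h' => h.ne (congrArg level h')
  have h1 : (fun n => resample x c c' (y, n)) = fun n => c (y, n) := by
    funext n; simp [resample, hne]
  have h2 : Enabled τ (resample x c c') η y = Enabled τ c η y :=
    funext fun u => propext (enabled_resample τ c c' η x u h.le)
  simp only [ZeroAt, h1, h2]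

theorem zeroAt_resample_self {d : ℕ} (τ : Site d → ℕ → ℝ) (c c' : Site d × ℕ → Fin 2)
    (η : Config d) (x : Site d) (s : ℝ) :
    ZeroAt τ (resample x c c') η x s ↔
      LastUpdateZero (τ x) (fun n => c' (x, n)) (η x = 0) (Enabled τ c η x) s := by
  have h1 : (fun n => resample x c c' (x, n)) = fun n => c' (x, n) := by
    funext n; simp [resample]
  have h2 : Enabled τ (resample x c c') η x = Enabled τ c η x :=
    funext fun u => propext (enabled_resample τ c c' η x u le_rfl)
  simp only [ZeroAt, h1, h2]

theorem measurable_resample {d : ℕ} (x : Site d) :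
    Measurable fun q : (Site d × ℕ → Fin 2) × (Site d × ℕ → Fin 2) => resample x q.1 q.2 := by
  refine measurable_pi_lambda _ fun k => ?_
  by_cases h : k.1 = x
  · simp only [resample, h, if_true]; fun_prop
  · simp only [resample, h, if_false]; fun_prop

theorem isProb_coinLaw (d : ℕ) {p : ℝ} (h0 : 0 < p) (h1 : p < 1) :
    IsProbabilityMeasure (coinLaw d p) := by
  have := isProb_bern h0 h1
  unfold coinLaw
  infer_instance

theorem map_resample {d : ℕ} {p : ℝ} (h0 : 0 < p) (h1 : p < 1) (x : Site d) :
    ((coinLaw d p).prod (coinLaw d p)).map (fun q => resample x q.1 q.2) = coinLaw d p := by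
  classical
  have := isProb_bern h0 h1
  have := isProb_coinLaw d h0 h1
  refine Measure.eq_infinitePi _ fun s t ht => ?_
  rw [Measure.map_apply (measurable_resample x)
    (.pi s.countable_toSet fun k _ => ht k)]
  have : (fun q : (Site d × ℕ → Fin 2) × (Site d × ℕ → Fin 2) => resample x q.1 q.2) ⁻¹'
      (s : Set (Site d × ℕ)).pi t =
      (Set.pi ((s.filter fun k => ¬ k.1 = x : Finset _) : Set (Site d × ℕ)) t) ×ˢ
        (Set.pi ((s.filter fun k => k.1 = x : Finset _) : Set (Site d × ℕ)) t) := by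
    ext q
    simp only [Set.mem_preimage, Set.mem_pi, Finset.mem_coe, resample, Set.mem_prod,
      Finset.mem_filter]
    constructor
    · intro h
      exact ⟨fun k hk => by simpa [hk.2] using h k hk.1, fun k hk => by simpa [hk.2] using h k hk.1⟩
    · intro h k hk
      by_cases hx : k.1 = x
      · simpa [hx] using h.2 k ⟨hk, hx⟩
      · simpa [hx] using h.1 k ⟨hk, hx⟩
  rw [this, Measure.prod_prod, coinLaw, Measure.infinitePi_pi _ (fun k _ => ht k),
    Measure.infinitePi_pi _ (fun k _ => ht k), mul_comm, Finset.prod_filter_mul_prod_filter_not]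

/-! ### A good site is often at zero -/

/-- The time that the spin at `x` is zero between time `0` and time `t`. -/
noncomputable def zeroTime {d : ℕ} (τ : Site d → ℕ → ℝ) (c : Site d × ℕ → Fin 2) (η : Config d)
    (t : ℝ) (x : Site d) : ENNReal :=
  volume.restrict (Set.Ioc 0 t) {s | ZeroAt τ c η x s}

theorem measurable_zeroTime {d : ℕ} (η : Config d) (t : ℝ) (x : Site d) :
    Measurable fun w : (Site d → ℕ → ℝ) × (Site d × ℕ → Fin 2) =>
      zeroTime (ringTime w.1) w.2 η t x :=
  measurable_measure_prodMk_right (measurableSet_setOfPred.2 (measurable_zeroAt η x))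

/-- Once a site has had an accepted ring, its spin is given by a fresh coin: for a fixed pattern of
accepted rings, it is zero with probability at least `1 - p`. -/
theorem lastUpdateZero_prob {d : ℕ} {p : ℝ} (h0 : 0 < p) (h1 : p < 1) (x : Site d) (τ : ℕ → ℝ)
    {z : Prop} {V : ℝ → Prop} {s : ℝ} (hz : z ∨ ∃ m, τ m ≤ s ∧ V (τ m)) :
    ENNReal.ofReal (1 - p) ≤ coinLaw d p {c | LastUpdateZero τ (fun n => c (x, n)) z V s} := by
  have := isProb_bern h0 h1
  have := isProb_coinLaw d h0 h1
  by_cases h : ∃ m, τ m ≤ s ∧ V (τ m) ∧ ∀ n, m < n → τ n ≤ s → ¬ V (τ n)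
  · obtain ⟨m, hm, hV, hlast⟩ := h
    calc ENNReal.ofReal (1 - p) = bern p {0} := by simp [bern]
      _ = coinLaw d p ((fun c : Site d × ℕ → Fin 2 => c (x, m)) ⁻¹' {0}) := by
        rw [← Measure.map_apply (measurable_pi_apply _) (by simp), coinLaw,
          Measure.infinitePi_map_eval (fun _ : Site d × ℕ => bern p)]
      _ ≤ _ := by
        refine measure_mono fun c hc => ⟨fun n hn hn' hn2 => ?_, fun hno => absurd hV (hno m hm)⟩
        have : n = m := by
          rcases lt_trichotomy n m with hl | hl | hl
          · exact absurd hV (hn2 m hl hm)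
          · exact hl
          · exact absurd hn' (hlast n hl hn)
        rw [this]; exact hc
  · have : {c : Site d × ℕ → Fin 2 | LastUpdateZero τ (fun n => c (x, n)) z V s} = Set.univ := by
      refine Set.eq_univ_of_forall fun c => ⟨fun m hm hV hl => absurd ⟨m, hm, hV, hl⟩ h,
        fun hno => hz.resolve_right ?_⟩
      rintro ⟨m, hm, hV⟩
      exact hno m hm hV
    rw [this, measure_univ, ← ENNReal.ofReal_one]
    exact ENNReal.ofReal_le_ofReal (by linarith)

/-- Whatever the clocks and the coins at other sites are, if they make `x` good, then the coins at
`x` give it a substantial time at zero with probability at least `(1 - p) / 2`: from time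
`(1 - p) / 4 * t` on, its spin is zero with probability at least `1 - p`. -/
theorem zeroTime_lt_le {d : ℕ} {p : ℝ} (h0 : 0 < p) (h1 : p < 1) {t : ℝ} (ht : 0 < t)
    (η : Config d) (x : Site d) (g : Site d → ℕ → ℝ) (c : Site d × ℕ → Fin 2)
    (hg : Good (ringTime g) c η ((1 - p) / 4 * t) x) :
    coinLaw d p {c' | zeroTime (ringTime g) (resample x c c') η t x <
      ENNReal.ofReal ((1 - p) / 4 * t)} ≤ ENNReal.ofReal ((1 + p) / 2) := by
  have := isProb_coinLaw d h0 h1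
  set a := (1 - p) / 4 * t with ha
  have ha0 : 0 < a := mul_pos (by linarith) ht
  set T : (Site d × ℕ → Fin 2) → ENNReal := fun c' => zeroTime (ringTime g) (resample x c c') η t x
  set A : Set (ℝ × (Site d × ℕ → Fin 2)) := {q | ZeroAt (ringTime g) (resample x c q.2) η x q.1}
  have hA : MeasurableSet A := by
    refine measurableSet_setOfPred.2 ((measurable_zeroAt η x).comp
      (g := fun q : ℝ × (Site d → ℕ → ℝ) × (Site d × ℕ → Fin 2) =>
        ZeroAt (ringTime q.2.1) q.2.2 η x q.1)
      (f := fun q : ℝ × (Site d × ℕ → Fin 2) => (q.1, g, resample x c q.2)) ?_)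
    exact measurable_fst.prodMk (measurable_const.prodMk
      ((measurable_resample x).comp (measurable_const.prodMk measurable_snd)))
  have hT : Measurable T := measurable_measure_prodMk_right hA
  have hlow : ENNReal.ofReal ((1 - p) * (t - a)) ≤ ∫⁻ c', T c' ∂(coinLaw d p) := by
    have h2 : ∫⁻ c', T c' ∂(coinLaw d p) =
        ∫⁻ s in Set.Ioc 0 t, coinLaw d p (Prod.mk s ⁻¹' A) := by
      rw [← Measure.prod_apply hA, Measure.prod_apply_symm hA]
      rfl
    rw [h2]
    calc ENNReal.ofReal ((1 - p) * (t - a)) = ∫⁻ _ in Set.Ioc a t, ENNReal.ofReal (1 - p) := by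
          rw [setLIntegral_const, Real.volume_Ioc, ENNReal.ofReal_mul (by linarith)]
      _ ≤ ∫⁻ s in Set.Ioc a t, coinLaw d p (Prod.mk s ⁻¹' A) := by
          refine setLIntegral_mono_ae' measurableSet_Ioc (Filter.Eventually.of_forall fun s hs => ?_)
          have h3 : Prod.mk s ⁻¹' A = {c' | LastUpdateZero (ringTime g x) (fun n => c' (x, n))
              (η x = 0) (Enabled (ringTime g) c η x) s} := by
            ext c'
            exact zeroAt_resample_self _ _ _ _ _ _
          rw [h3]
          refine lastUpdateZero_prob h0 h1 x _ (hg.imp_right ?_)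
          rintro ⟨m, hm, hV⟩
          exact ⟨m, hm.trans hs.1.le, hV⟩
      _ ≤ _ := lintegral_mono_set (Set.Ioc_subset_Ioc_left ha0.le)
  -- Markov's inequality for `t - T`: the time `T` is below `a` on `F`, and at most `t` elsewhere.
  set F : Set (Site d × ℕ → Fin 2) := {c' | T c' < ENNReal.ofReal a}
  have hF : MeasurableSet F := measurableSet_lt hT measurable_const
  have hup : ∫⁻ c', T c' ∂(coinLaw d p) ≤
      ENNReal.ofReal a * coinLaw d p F + ENNReal.ofReal t * coinLaw d p Fᶜ := by
    rw [← lintegral_add_compl _ hF]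
    refine add_le_add ?_ ?_
    · rw [← setLIntegral_const]
      exact setLIntegral_mono measurable_const fun c' hc' => hc'.le
    · rw [← setLIntegral_const]
      refine setLIntegral_mono measurable_const fun c' _ => ?_
      refine (measure_mono (Set.subset_univ _)).trans ?_
      simp
  rw [← ofReal_measureReal, ← ofReal_measureReal (s := Fᶜ), probReal_compl_eq_one_sub hF,
    ← ENNReal.ofReal_mul ha0.le, ← ENNReal.ofReal_mul ht.le, ← ENNReal.ofReal_add
      (mul_nonneg ha0.le measureReal_nonneg)
      (mul_nonneg ht.le (sub_nonneg.2 measureReal_le_one))] at hup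
  have h4 := (ENNReal.ofReal_le_ofReal_iff (by
    refine add_nonneg (mul_nonneg ha0.le measureReal_nonneg)
      (mul_nonneg ht.le (sub_nonneg.2 measureReal_le_one)))).1 (hlow.trans hup)
  rw [← ofReal_measureReal]
  refine ENNReal.ofReal_le_ofReal ?_
  set q := (coinLaw d p).real F
  have hq1 : q ≤ 1 := measureReal_le_one
  have h5 : t * q ≤ t * ((1 + p) / 2) := by
    have h6 : a * q ≤ a := mul_le_of_le_one_right ha0.le hq1
    have h7 : (1 - p) * a ≤ (1 - p) / 4 * t := by
      rw [ha]; nlinarith [mul_pos (sub_pos.2 h1) ht, mul_pos (mul_pos (sub_pos.2 h1) ht) h0]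
    nlinarith
  exact le_of_mul_le_mul_left h5 ht

/-- A condition on the clocks and coins that does not involve the coins at `x`, and implies that
`x` is good, becomes less likely by a fixed factor when it is required in addition that `x` spends
little time at zero. -/
theorem measure_inter_zeroTime_lt_le {d : ℕ} {p : ℝ} (h0 : 0 < p) (h1 : p < 1) {t : ℝ} (ht : 0 < t)
    (η : Config d) (x : Site d) (μ : Measure (Site d → ℕ → ℝ)) [IsProbabilityMeasure μ]
    {E : Set ((Site d → ℕ → ℝ) × (Site d × ℕ → Fin 2))} (hE : MeasurableSet E)
    (hinv : ∀ g c c', (g, resample x c c') ∈ E ↔ (g, c) ∈ E)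
    (hg : ∀ w ∈ E, Good (ringTime w.1) w.2 η ((1 - p) / 4 * t) x) :
    μ.prod (coinLaw d p) (E ∩ {w | zeroTime (ringTime w.1) w.2 η t x <
      ENNReal.ofReal ((1 - p) / 4 * t)}) ≤
      ENNReal.ofReal ((1 + p) / 2) * μ.prod (coinLaw d p) E := by
  have := isProb_coinLaw d h0 h1
  set F := {w : (Site d → ℕ → ℝ) × (Site d × ℕ → Fin 2) | zeroTime (ringTime w.1) w.2 η t x <
      ENNReal.ofReal ((1 - p) / 4 * t)}
  have hF : MeasurableSet F := measurableSet_lt (measurable_zeroTime η t x) measurable_const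
  rw [Measure.prod_apply (hE.inter hF), Measure.prod_apply hE,
    ← lintegral_const_mul _ (measurable_measure_prodMk_left hE)]
  refine lintegral_mono fun g => ?_
  have hEg : MeasurableSet (Prod.mk g ⁻¹' E) := measurable_prodMk_left hE
  have hEFg : MeasurableSet (Prod.mk g ⁻¹' (E ∩ F)) := measurable_prodMk_left (hE.inter hF)
  conv_lhs => rw [← map_resample h0 h1 x]
  rw [Measure.map_apply (measurable_resample x) hEFg,
    Measure.prod_apply (measurable_resample x hEFg)]
  calc _ ≤ ∫⁻ c, (Prod.mk g ⁻¹' E).indicator (fun _ => ENNReal.ofReal ((1 + p) / 2)) c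
        ∂(coinLaw d p) := by
        refine lintegral_mono fun c => ?_
        by_cases hc : (g, c) ∈ E
        · rw [Set.indicator_of_mem (by exact hc)]
          refine (measure_mono ?_).trans (zeroTime_lt_le h0 h1 ht η x g c (hg _ hc))
          exact fun c' hc' => hc'.2
        · rw [Set.indicator_of_notMem (by exact hc)]
          refine le_of_eq (measure_mono_null ?_ measure_empty)
          exact fun c' hc' => hc ((hinv g c c').1 hc'.1)
    _ = _ := by rw [lintegral_indicator_const hEg]

/-! ### Many levels with good sites -/

/-- Some site of `S` is good, and every site of `S` spends less than the time `a` at zero. -/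
def failSet {d : ℕ} (η : Config d) (t a : ℝ) (S : Finset (Site d)) :
    Set ((Site d → ℕ → ℝ) × (Site d × ℕ → Fin 2)) :=
  {w | (∃ x ∈ S, Good (ringTime w.1) w.2 η a x) ∧
    ∀ x ∈ S, zeroTime (ringTime w.1) w.2 η t x < ENNReal.ofReal a}

theorem measurableSet_failSet {d : ℕ} (η : Config d) (t a : ℝ) (S : Finset (Site d)) :
    MeasurableSet (failSet η t a S) := by
  refine measurableSet_setOfPred.2 (Measurable.and ?_ ?_)
  · exact Measurable.exists fun x => measurable_const.and (measurable_good η a x)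
  · exact Measurable.forall fun x => measurable_const.imp
      (measurableSet_setOfPred.1 (measurableSet_lt (measurable_zeroTime η t x) measurable_const))

theorem failSet_resample {d : ℕ} (η : Config d) (t a : ℝ) {S : Finset (Site d)} {x : Site d}
    (hS : ∀ y ∈ S, level y < level x) (g : Site d → ℕ → ℝ) (c c' : Site d × ℕ → Fin 2) :
    (g, resample x c c') ∈ failSet η t a S ↔ (g, c) ∈ failSet η t a S := by
  refine and_congr ?_ ?_
  · exact exists_congr fun y => and_congr_right fun hy => good_resample _ _ _ _ _ _ (hS y hy).le
  · refine forall_congr' fun y => forall_congr' fun hy => ?_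
    simp only [zeroTime, zeroAt_resample_of_lt _ _ _ _ _ _ (hS y hy)]

/-- The failure of one level, given an event that does not involve the coins at this level. The
induction on `S` conditions on the first site of `S` that is good. -/
theorem measure_inter_failSet_le {d : ℕ} {p : ℝ} (h0 : 0 < p) (h1 : p < 1) {t : ℝ} (ht : 0 < t)
    (η : Config d) (μ : Measure (Site d → ℕ → ℝ)) [IsProbabilityMeasure μ] (L : ℤ)
    (S : Finset (Site d)) (hS : ∀ x ∈ S, level x = L)
    {E : Set ((Site d → ℕ → ℝ) × (Site d × ℕ → Fin 2))} (hE : MeasurableSet E)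
    (hinv : ∀ x, level x = L → ∀ g c c', (g, resample x c c') ∈ E ↔ (g, c) ∈ E) :
    μ.prod (coinLaw d p) (E ∩ failSet η t ((1 - p) / 4 * t) S) ≤
      ENNReal.ofReal ((1 + p) / 2) * μ.prod (coinLaw d p) E := by
  classical
  have := isProb_coinLaw d h0 h1
  induction S using Finset.induction_on generalizing E with
  | empty => simp [failSet]
  | insert x S _ ih =>
    set a := (1 - p) / 4 * t
    set G := {w : (Site d → ℕ → ℝ) × (Site d × ℕ → Fin 2) | Good (ringTime w.1) w.2 η a x}
    have hG : MeasurableSet G := measurableSet_setOfPred.2 (measurable_good η a x)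
    have hGinv : ∀ y, level y = L → ∀ g c c', (g, resample y c c') ∈ G ↔ (g, c) ∈ G :=
      fun y hy g c c' => good_resample _ _ _ _ _ _ (by rw [hy, hS x (by simp)])
    have hxL : level x = L := hS x (by simp)
    have hgood := measure_inter_zeroTime_lt_le h0 h1 ht η x μ (hE.inter hG)
      (fun g c c' => and_congr (hinv x hxL g c c') (hGinv x hxL g c c')) (fun w hw => hw.2)
    have hbad := ih (fun y hy => hS y (by simp [hy])) (hE.inter hG.compl)
      (fun y hy g c c' => and_congr (hinv y hy g c c') (not_congr (hGinv y hy g c c')))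
    calc _ ≤ μ.prod (coinLaw d p) ((E ∩ G) ∩ {w | zeroTime (ringTime w.1) w.2 η t x <
            ENNReal.ofReal a} ∪ (E ∩ Gᶜ) ∩ failSet η t a S) := by
          refine measure_mono ?_
          rintro w ⟨hw, ⟨y, hy, hyg⟩, hlt⟩
          by_cases hwG : w ∈ G
          · exact Or.inl ⟨⟨hw, hwG⟩, hlt x (by simp)⟩
          · refine Or.inr ⟨⟨hw, hwG⟩, ⟨y, ?_, hyg⟩, fun z hz => hlt z (by simp [hz])⟩
            rcases Finset.mem_insert.1 hy with rfl | hy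
            · exact absurd hyg hwG
            · exact hy
      _ ≤ _ := (measure_union_le _ _).trans (add_le_add hgood hbad)
      _ = ENNReal.ofReal ((1 + p) / 2) * μ.prod (coinLaw d p) E := by
          rw [← mul_add, ← Set.sdiff_eq, measure_inter_add_sdiff _ hG]

/-- The factor of each level accumulates from the lowest level upwards, because the events at the
levels below do not involve the coins at the current one. -/
theorem measure_failSet_levels_le {d : ℕ} {p : ℝ} (h0 : 0 < p) (h1 : p < 1) {t : ℝ} (ht : 0 < t)
    (η : Config d) (μ : Measure (Site d → ℕ → ℝ)) [IsProbabilityMeasure μ] (L : ℤ)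
    (S : ℕ → Finset (Site d)) (hS : ∀ j, ∀ x ∈ S j, level x = L + j) (n : ℕ) :
    μ.prod (coinLaw d p) {w | ∀ j < n, w ∈ failSet η t ((1 - p) / 4 * t) (S j)} ≤
      ENNReal.ofReal ((1 + p) / 2) ^ n := by
  have := isProb_coinLaw d h0 h1
  induction n with
  | zero => simp
  | succ n ih =>
    set a := (1 - p) / 4 * t
    have hsucc : {w | ∀ j < n + 1, w ∈ failSet η t a (S j)} =
        {w | ∀ j < n, w ∈ failSet η t a (S j)} ∩ failSet η t a (S n) := by
      ext w
      simp only [Set.mem_ofPred_eq, Set.mem_inter_iff, Nat.lt_succ_iff_lt_or_eq, or_imp,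
        forall_and, forall_eq]
    have hmeas : MeasurableSet {w | ∀ j < n, w ∈ failSet η t a (S j)} :=
      measurableSet_setOfPred.2 (Measurable.forall fun j => measurable_const.imp
        (measurableSet_setOfPred.1 (measurableSet_failSet η t a (S j))))
    rw [hsucc, pow_succ']
    refine (measure_inter_failSet_le h0 h1 ht η μ (L + n) (S n) (hS n) hmeas ?_).trans
      (by gcongr)
    intro x hx g c c'
    refine forall_congr' fun j => forall_congr' fun hj => ?_
    refine failSet_resample η t a (fun y hy => ?_) g c c'
    rw [hS j y hy, hx]
    omega

/-! ### A chain of good sites -/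

theorem IsEastPath.timeAtZero_eq {d : ℕ} {g : Site d → ℕ → ℝ} {c : Site d × ℕ → Fin 2}
    {η : Config d} {ξ : ℝ → Config d} (hξ : IsEastPath (ringTime g) (fun x n => c (x, n)) η ξ)
    (hτ : RegularTimes (ringTime g)) {t : ℝ} (ht : 0 ≤ t) (x : Site d) :
    timeAtZero ξ t x = (zeroTime (ringTime g) c η t x).toReal := by
  have hm : MeasurableSet {s | ZeroAt (ringTime g) c η x s} :=
    measurableSet_setOfPred.2 ((measurable_zeroAt η x).comp
      (g := fun q : ℝ × (Site d → ℕ → ℝ) × (Site d × ℕ → Fin 2) =>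
        ZeroAt (ringTime q.2.1) q.2.2 η x q.1) (f := fun s : ℝ => (s, g, c)) (by fun_prop))
  calc timeAtZero ξ t x
      = ∫ s in Set.Ioc 0 t, {s | ZeroAt (ringTime g) c η x s}.indicator 1 s := by
        rw [timeAtZero, intervalIntegral.integral_of_le ht]
        refine setIntegral_congr_fun measurableSet_Ioc fun s hs => ?_
        have h : s ∈ {s | ZeroAt (ringTime g) c η x s} ↔ ξ s x = 0 :=
          hξ.zeroAt_iff hτ x hs.1.le
        by_cases hz : ξ s x = 0
        · rw [Set.indicator_of_mem (h.2 hz)]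
          simp [hz]
        · rw [Set.indicator_of_notMem fun hm => hz (h.1 hm)]
          simp [hz]
    _ = _ := by
        rw [integral_indicator_one hm]
        rfl

theorem IsEastPath.le_timeAtZero {d : ℕ} {g : Site d → ℕ → ℝ} {c : Site d × ℕ → Fin 2}
    {η : Config d} {ξ : ℝ → Config d} (hξ : IsEastPath (ringTime g) (fun x n => c (x, n)) η ξ)
    (hτ : RegularTimes (ringTime g)) {a t : ℝ} (ha : 0 ≤ a) (hat : a ≤ t) {x : Site d}
    (h : ∀ s, 0 ≤ s → s ≤ a → ξ s x = 0) : a ≤ timeAtZero ξ t x := by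
  rw [hξ.timeAtZero_eq hτ (ha.trans hat) x]
  refine (ENNReal.ofReal_le_iff_le_toReal (measure_ne_top _ _)).1 ?_
  calc ENNReal.ofReal a = volume.restrict (Set.Ioc 0 t) (Set.Ioc 0 a) := by
        rw [Measure.restrict_apply measurableSet_Ioc,
          Set.inter_eq_left.2 (Set.Ioc_subset_Ioc_right hat), Real.volume_Ioc, sub_zero]
    _ ≤ _ := measure_mono fun s hs => (hξ.zeroAt_iff hτ x hs.1.le).2 (h s hs.1.le hs.2)

/-- A site that is at zero at some time up to `a` is good: it starts from zero, or some accepted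
ring brought it there. -/
theorem IsEastPath.good_of_zero {d : ℕ} {τ : Site d → ℕ → ℝ} {c : Site d × ℕ → Fin 2}
    {η : Config d} {ξ : ℝ → Config d} (hξ : IsEastPath τ (fun x n => c (x, n)) η ξ)
    (hτ : RegularTimes τ) {a s : ℝ} (hs : 0 ≤ s) (hsa : s ≤ a) {x : Site d} (h : ξ s x = 0) :
    Good τ c η a x := by
  by_contra hg
  simp only [Good, not_or, not_exists, not_and] at hg
  refine hg.1 ?_
  rw [← hξ.initial, ← h]
  refine (hξ.constant x 0 s le_rfl hs fun n _ hn => ?_).symm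
  rw [← hξ.enabled_iff hτ x (hτ.pos x n).le]
  exact hg.2 n (hn.trans hsa)

/-- A good site that spends little time at zero has a good neighbour of lower level: it must have
an accepted ring up to time `a`, at which one of these neighbours is at zero. -/
theorem IsEastPath.exists_good_neighbour {d : ℕ} {g : Site d → ℕ → ℝ}
    {c : Site d × ℕ → Fin 2} {η : Config d} {ξ : ℝ → Config d}
    (hξ : IsEastPath (ringTime g) (fun x n => c (x, n)) η ξ) (hτ : RegularTimes (ringTime g))
    {a t : ℝ} (ha : 0 ≤ a) (hat : a ≤ t) {x : Site d} (hx : Good (ringTime g) c η a x)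
    (hlt : timeAtZero ξ t x < a) : ∃ i, Good (ringTime g) c η a (x - e i) := by
  by_cases hring : ∃ m, ringTime g x m ≤ a ∧ Enabled (ringTime g) c η x (ringTime g x m)
  · obtain ⟨m, hm, hen⟩ := hring
    obtain ⟨i, hi⟩ := (hξ.enabled_iff hτ x (hτ.pos x m).le).1 hen
    exact ⟨i, hξ.good_of_zero hτ (hτ.pos x m).le hm hi⟩
  · refine absurd (hξ.le_timeAtZero hτ ha hat fun s hs hsa => ?_) (not_le.2 hlt)
    rw [hξ.constant x 0 s le_rfl hs fun n _ hn => ?_, hξ.initial]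
    · exact hx.resolve_right hring
    · rw [← hξ.enabled_iff hτ x (hτ.pos x n).le]
      exact fun h => hring ⟨n, hn.trans hsa, h⟩

theorem IsEastPath.exists_good_chain {d : ℕ} {g : Site d → ℕ → ℝ} {c : Site d × ℕ → Fin 2}
    {η : Config d} {ξ : ℝ → Config d}
    (hξ : IsEastPath (ringTime g) (fun x n => c (x, n)) η ξ) (hτ : RegularTimes (ringTime g))
    {a t : ℝ} (ha : 0 ≤ a) (hat : a ≤ t) {r r' : ℝ} {x₀ : Site d} (hx₀ : x₀ ∈ box d r)
    (hη : η x₀ = 0) (hlt : ∀ x ∈ box d r', timeAtZero ξ t x < a) (k : ℕ)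
    (hk : ⌊r⌋ + k ≤ ⌊r'⌋) :
    ∃ x ∈ box d r', level x = level x₀ - k ∧ Good (ringTime g) c η a x := by
  suffices h : ∃ x : Site d, (∀ i, -⌊r⌋ - k ≤ x i ∧ x i ≤ 0) ∧ level x = level x₀ - k ∧
      Good (ringTime g) c η a x by
    obtain ⟨x, hx, h⟩ := h
    exact ⟨x, fun i => ⟨by linarith [(hx i).1], (hx i).2⟩, h⟩
  induction k with
  | zero => exact ⟨x₀, by simpa [box] using hx₀, by simp, Or.inl hη⟩
  | succ k ih =>
    push_cast at hk
    obtain ⟨x, hx, hl, hg⟩ := ih (by omega)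
    obtain ⟨i, hi⟩ := hξ.exists_good_neighbour hτ ha hat hg
      (hlt x fun i => ⟨by linarith [(hx i).1], (hx i).2⟩)
    refine ⟨x - e i, fun j => ?_, by rw [level_sub_e, hl]; push_cast; ring, hi⟩
    have h1 : (0 : ℤ) ≤ (e i : Site d) j ∧ (e i : Site d) j ≤ 1 := by
      by_cases hj : j = i
      · subst hj; simp [e]
      · simp [e, hj]
    have := hx j
    simp only [Pi.sub_apply]
    push_cast
    constructor <;> omega

/-! ### The law of the clocks and the coins -/

theorem nonempty_finiteSpanningSetsIn_squareCylinders {ι Z : Type*} [MeasurableSpace Z]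
    (ρ : Measure (ι → Z)) [IsProbabilityMeasure ρ] :
    Nonempty (ρ.FiniteSpanningSetsIn
      (squareCylinders fun _ : ι => {s : Set Z | MeasurableSet s})) :=
  ⟨⟨fun _ => Set.univ, fun _ => ⟨∅, fun _ => Set.univ, fun _ _ => MeasurableSet.univ, by simp⟩,
    fun _ => measure_lt_top _ _, Set.iUnion_const _⟩⟩

/-- Independent pairs with independent components form two independent families. -/
theorem infinitePi_prod_unzip {ι X Y : Type*} [MeasurableSpace X] [MeasurableSpace Y]
    (μ : Measure X) (ν : Measure Y) [IsProbabilityMeasure μ] [IsProbabilityMeasure ν] :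
    (Measure.infinitePi fun _ : ι => μ.prod ν).map
        (fun w => ((fun k => (w k).1 : ι → X), (fun k => (w k).2 : ι → Y))) =
      (Measure.infinitePi fun _ : ι => μ).prod (Measure.infinitePi fun _ : ι => ν) := by
  classical
  -- It suffices to compare the two measures on products of square cylinders.
  refine (Measure.prod_eq_generateFrom generateFrom_squareCylinders generateFrom_squareCylinders
    (isPiSystem_squareCylinders (fun _ => MeasurableSpace.isPiSystem_measurableSet)
      fun _ => MeasurableSet.univ)
    (isPiSystem_squareCylinders (fun _ => MeasurableSpace.isPiSystem_measurableSet)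
      fun _ => MeasurableSet.univ)
    (nonempty_finiteSpanningSetsIn_squareCylinders _).some
    (nonempty_finiteSpanningSetsIn_squareCylinders _).some ?_).symm
  rintro _ ⟨S, a, ha, rfl⟩ _ ⟨T, b, hb, rfl⟩
  have ha' : ∀ k, MeasurableSet (a k) := fun k => ha k trivial
  have hb' : ∀ k, MeasurableSet (b k) := fun k => hb k trivial
  have hpre : (fun w : ι → X × Y => ((fun k => (w k).1 : ι → X), (fun k => (w k).2 : ι → Y))) ⁻¹'
      ((S : Set ι).pi a ×ˢ (T : Set ι).pi b) = ((S ∪ T : Finset ι) : Set ι).pi fun k =>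
        (if k ∈ S then a k else Set.univ) ×ˢ (if k ∈ T then b k else Set.univ) := by
    ext w
    simp only [Set.mem_preimage, Set.mem_prod, Set.mem_pi, Finset.mem_coe, Finset.mem_union]
    constructor
    · rintro ⟨h1, h2⟩ k _
      refine ⟨?_, ?_⟩
      · split_ifs with h
        exacts [h1 k h, trivial]
      · split_ifs with h
        exacts [h2 k h, trivial]
    · intro h
      exact ⟨fun k hk => by simpa [hk] using (h k (Or.inl hk)).1,
        fun k hk => by simpa [hk] using (h k (Or.inr hk)).2⟩
  rw [Measure.map_apply (by fun_prop) ((MeasurableSet.pi S.countable_toSet fun k _ => ha' k).prod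
      (MeasurableSet.pi T.countable_toSet fun k _ => hb' k)), hpre,
    Measure.infinitePi_pi _ fun k _ => ?_, Measure.infinitePi_pi _ fun k _ => ha' k,
    Measure.infinitePi_pi _ fun k _ => hb' k]
  · simp only [Measure.prod_prod, Finset.prod_mul_distrib]
    congr 1
    · rw [← Finset.prod_subset (Finset.subset_union_left (s₁ := S) (s₂ := T))
        fun k _ hk => by simp [hk]]
      exact Finset.prod_congr rfl fun k hk => by simp [hk]
    · rw [← Finset.prod_subset (Finset.subset_union_right (s₁ := S) (s₂ := T))
        fun k _ hk => by simp [hk]]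
      exact Finset.prod_congr rfl fun k hk => by simp [hk]
  · refine MeasurableSet.prod ?_ ?_
    · split_ifs
      exacts [ha' k, .univ]
    · split_ifs
      exacts [hb' k, .univ]

/-- The law of the independent exponential waiting times at every site. -/
noncomputable def gapLaw (d : ℕ) : Measure (Site d → ℕ → ℝ) :=
  Measure.infinitePi fun _ => Measure.infinitePi fun _ => expMeasure 1

theorem map_coin_eq_bern {Ω : Type*} [MeasurableSpace Ω] (P : Measure Ω) [IsProbabilityMeasure P]
    {p : ℝ} (h0 : 0 < p) {b : Ω → Fin 2} (hb : Measurable b)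
    (h : P {ω | b ω = 1} = ENNReal.ofReal p) : P.map b = bern p := by
  change P (b ⁻¹' {1}) = _ at h
  have h0' : P (b ⁻¹' {0}) = ENNReal.ofReal (1 - p) := by
    have hc : b ⁻¹' {0} = (b ⁻¹' {1})ᶜ := by
      ext ω
      simp only [Set.mem_preimage, Set.mem_singleton_iff, Set.mem_compl_iff]
      omega
    rw [hc, prob_compl_eq_one_sub (hb (measurableSet_singleton 1)), h,
      ENNReal.ofReal_sub _ h0.le, ENNReal.ofReal_one]
  refine Measure.ext_of_singleton fun i => ?_
  rw [Measure.map_apply hb (measurableSet_singleton i)]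
  fin_cases i
  · simpa [bern] using h0'
  · simpa [bern] using h

theorem IsGraphicalConstruction.map_eq {d : ℕ} {Ω : Type*} [MeasurableSpace Ω] {P : Measure Ω}
    [IsProbabilityMeasure P] {p : ℝ} (h0 : 0 < p) (h1 : p < 1) {gap : Site d → ℕ → Ω → ℝ}
    {coin : Site d → ℕ → Ω → Fin 2} (h : IsGraphicalConstruction P p gap coin) :
    P.map (fun ω => ((fun x n => gap x n ω : Site d → ℕ → ℝ),
      (fun k => coin k.1 k.2 ω : Site d × ℕ → Fin 2))) = (gapLaw d).prod (coinLaw d p) := by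
  have := isProbabilityMeasure_expMeasure one_pos
  have := isProb_bern h0 h1
  have hmg := h.measurable_gap
  have hmc := h.measurable_coin
  have hpair : P.map (fun ω (k : Site d × ℕ) => (gap k.1 k.2 ω, coin k.1 k.2 ω)) =
      Measure.infinitePi fun _ => (expMeasure 1).prod (bern p) := by
    rw [h.iIndepFun_pair.map_fun_eq_infinitePi_map fun k => by fun_prop]
    congr 1
    funext k
    rw [(indepFun_iff_map_prod_eq_prod_map_map (hmg k.1 k.2).aemeasurable
      (hmc k.1 k.2).aemeasurable).1 (h.indepFun_gap_coin k.1 k.2), h.gap_law,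
      map_coin_eq_bern P h0 (hmc k.1 k.2) (h.coin_law k.1 k.2)]
  have hunzip := infinitePi_prod_unzip (ι := Site d × ℕ) (expMeasure 1) (bern p)
  rw [← hpair, Measure.map_map (by fun_prop) (by fun_prop)] at hunzip
  have hcurry := Measure.infinitePi_map_curry fun (_ : Site d) (_ : ℕ) => expMeasure 1
  rw [gapLaw, coinLaw, ← hcurry]
  conv_rhs => rw [← Measure.map_id (μ := Measure.infinitePi fun _ : Site d × ℕ => bern p)]
  rw [Measure.map_prod_map _ _ (by fun_prop) measurable_id, ← hunzip,
    Measure.map_map (by fun_prop) (by fun_prop)]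
  rfl

/-- Almost surely the ring times are positive, strictly increasing and unbounded at every site,
and no infinite chain of neighbouring rings goes back in time: in short time slabs, the sites with
a ring form a subcritical oriented percolation. -/
theorem ae_regularTimes (d : ℕ) : ∀ᵐ g ∂(gapLaw d), RegularTimes (ringTime g) := by
  have := isProbabilityMeasure_expMeasure one_pos
  let ν : Measure (ℕ → ℝ) := Measure.infinitePi fun _ => expMeasure 1
  let f : ℕ → (ℕ → ℝ) → ℝ := fun n w => w n
  have hfm : ∀ n, Measurable (f n) := fun n => by fun_prop
  have hflaw : ∀ n, ν.map (f n) = expMeasure 1 := fun n => Measure.infinitePi_map_eval _ n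
  have hfind : iIndepFun f ν := iIndepFun_infinitePi (X := fun _ z => z) fun _ => measurable_id
  have hsite : ∀ q : (ℕ → ℝ) → Prop, (∀ᵐ w ∂ν, q w) → ∀ᵐ g ∂(gapLaw d), ∀ x, q (g x) := by
    intro q hq
    rw [ae_all_iff]
    intro x
    have hx : (gapLaw d).map (fun g => g x) = ν :=
      Measure.infinitePi_map_eval (fun _ : Site d => ν) x
    rw [← hx] at hq
    exact ae_of_ae_map (measurable_pi_apply x).aemeasurable hq
  have hunb : ∀ᵐ w ∂ν, ∀ T : ℕ, ∃ n, (T : ℝ) < ∑ k ∈ Finset.range (n + 1), w k := by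
    rw [ae_all_iff]
    intro T
    rw [ae_iff]
    refine le_antisymm (ge_of_tendsto' (ring_tail ν f hfm hflaw hfind T) fun n => ?_) zero_le
    refine measure_mono fun w hw => ?_
    simp only [not_exists, not_lt, Set.mem_ofPred_eq] at hw
    exact hw n
  obtain ⟨ε, hε0, hε⟩ : ∃ ε : ENNReal, 0 < ε ∧ d * ε ≤ 2⁻¹ := by
    refine ⟨2⁻¹ / (d + 1 : ℕ), by simp [ENNReal.div_pos_iff], ?_⟩
    rw [← mul_div_assoc, mul_comm, mul_div_assoc]
    refine mul_le_of_le_one_right' ?_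
    exact ENNReal.div_le_of_le_mul (by rw [one_mul]; exact_mod_cast Nat.le_succ d)
  choose δ hδ0 hδ using fun T : ℕ => slab_small ν f hfm hflaw hfind T ε hε0
  let R : ℕ → ℕ → Set (ℕ → ℝ) := fun T k =>
    {w | ∃ n, k * δ T < ∑ l ∈ Finset.range (n + 1), w l ∧
      ∑ l ∈ Finset.range (n + 1), w l ≤ k * δ T + δ T}
  have hR : ∀ T k, MeasurableSet (R T k) := by
    intro T k
    have : R T k = ⋃ n, (fun w => ∑ l ∈ Finset.range (n + 1), w l) ⁻¹'
        Set.Ioc (k * δ T) (k * δ T + δ T) := by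
      ext w; simp [R]
    rw [this]
    exact MeasurableSet.iUnion fun n => measurableSet_Ioc.preimage (by fun_prop)
  have hslab : ∀ᵐ g ∂(gapLaw d), ∀ (T k : ℕ), k * δ T ≤ T → ∀ x : Site d,
      ¬ ∃ f : ℕ → Site d, f 0 = x ∧ (∀ j, ∃ i, f (j + 1) = f j - e i) ∧
        ∀ j, g (f j) ∈ R T k := by
    simp only [ae_all_iff]
    intro T k hk x
    exact no_infinite_path ν (R T k) (hR T k)
      ((mul_le_mul_right (hδ T _ hk) _).trans hε) x
  filter_upwards [hslab, hsite _ (gap_pos_ae ν f hfm hflaw), hsite _ hunb] with g h1 h2 h3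
  have hpos : ∀ x n, 0 < ringTime g x n := fun x n =>
    Finset.sum_pos (fun k _ => h2 x k) ⟨0, by simp⟩
  have hmono : ∀ x, StrictMono (ringTime g x) := fun x => by
    refine strictMono_nat_of_lt_succ fun n => ?_
    simp only [ringTime]
    rw [Finset.sum_range_succ _ (n + 1)]
    exact lt_add_of_pos_right _ (h2 x (n + 1))
  refine ⟨hpos, hmono, fun x s => ?_, wf_of_slabs _ hpos δ hδ0 ?_⟩
  · obtain ⟨T, hT⟩ := exists_nat_ge s
    obtain ⟨n, hn⟩ := h3 x T
    refine (Set.finite_Iio n).subset fun m hm => ?_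
    exact (hmono x).lt_iff_lt.1 ((le_trans hm hT).trans_lt hn)
  · rintro T k hk ⟨f, hf, hf'⟩
    exact h1 T k hk (f 0) ⟨f, rfl, hf, hf'⟩

end EastModel

open EastModel in
theorem proposition3 (d : ℕ) (hd : 1 ≤ d) (p : ℝ) (hp0 : 0 < p) (hp1 : p < 1)
    (α : ℝ) (hα : 0 < α) :
    ∃ c C : ℝ, 0 < c ∧ 0 < C ∧
      ∀ (t : ℝ), 0 ≤ t →
      ∀ (η : EastModel.Config d), (∃ x ∈ EastModel.box d (α * t), η x = 0) →
      ∀ (Ω : Type*) [MeasurableSpace Ω] (P : Measure Ω) [IsProbabilityMeasure P]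
        (X : ℝ → Ω → EastModel.Config d), EastModel.IsEastProcess P p η X →
        P.real (EastModel.zeroEvent p α X t)ᶜ ≤ C * Real.exp (-c * t) := by
  set r : ℝ := (1 + p) / 2 with hr
  have hr0 : 0 < r := by rw [hr]; linarith
  have hr1 : r < 1 := by rw [hr]; linarith
  refine ⟨-(α * Real.log r), 1, neg_pos.2 (mul_neg_of_pos_of_neg hα (Real.log_neg hr0 hr1)),
    one_pos, ?_⟩
  intro t ht η ⟨x₀, hx₀, hη⟩ Ω _ P _ X ⟨gap, coin, hG, hX⟩
  rcases ht.eq_or_lt with rfl | ht0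
  · simp
  have := isProb_coinLaw d hp0 hp1
  have := isProbabilityMeasure_expMeasure one_pos
  have : IsProbabilityMeasure (gapLaw d) := by unfold gapLaw; infer_instance
  set a := (1 - p) / 4 * t with ha
  have ha0 : 0 < a := mul_pos (by linarith) ht0
  have hat : a ≤ t := by rw [ha]; nlinarith
  set N : ℕ := ⌊α * t⌋.toNat with hN
  have hNZ : (N : ℤ) = ⌊α * t⌋ := Int.toNat_of_nonneg (Int.floor_nonneg.2 (by positivity))
  have hfloor : ⌊α * t⌋ + N ≤ ⌊2 * d * α * t⌋ := by
    have hd' : (1 : ℝ) ≤ d := by exact_mod_cast hd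
    rw [hNZ, Int.le_floor]
    push_cast
    nlinarith [Int.floor_le (α * t), mul_pos hα ht0,
      mul_le_mul_of_nonneg_right hd' (mul_pos hα ht0).le]
  -- The `N + 1` levels that end with the one of `x₀`, enumerated from the lowest.
  let S : ℕ → Finset (Site d) := fun j =>
    (Finset.Icc (fun _ => -⌊2 * d * α * t⌋ : Site d) 0).filter fun x =>
      level x = (level x₀ - N) + j
  have hbox : ∀ x : Site d, x ∈ Finset.Icc (fun _ => -⌊2 * d * α * t⌋ : Site d) 0 ↔
      x ∈ box d (2 * d * α * t) := fun x => by
    simp only [Finset.mem_Icc, Pi.le_def, box, Set.mem_ofPred_eq, ← forall_and, Pi.zero_apply]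
  set F := {w : (Site d → ℕ → ℝ) × (Site d × ℕ → Fin 2) |
    ∀ j < N + 1, w ∈ failSet η t a (S j)}
  have hFm : MeasurableSet F :=
    measurableSet_setOfPred.2 (Measurable.forall fun j => measurable_const.imp
        (measurableSet_setOfPred.1 (measurableSet_failSet η t a (S j))))
  let Φ : Ω → (Site d → ℕ → ℝ) × (Site d × ℕ → Fin 2) := fun ω =>
    (fun x n => gap x n ω, fun k => coin k.1 k.2 ω)
  have hmg := hG.measurable_gap
  have hmc := hG.measurable_coin
  have hΦ : Measurable Φ := by fun_prop
  have hΦlaw : P.map Φ = (gapLaw d).prod (coinLaw d p) := hG.map_eq hp0 hp1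
  have hreg : ∀ᵐ ω ∂P, RegularTimes (ringTime (Φ ω).1) := by
    have h1 := Measure.quasiMeasurePreserving_fst.ae (μa := (gapLaw d).prod (coinLaw d p))
      (ae_regularTimes d)
    rw [← hΦlaw] at h1
    exact ae_of_ae_map hΦ.aemeasurable h1
  have hle : P (zeroEvent p α X t)ᶜ ≤ P (Φ ⁻¹' F) := by
    refine measure_mono_ae ?_
    filter_upwards [hX, hreg] with ω hω hτ hfail
    have hlt : ∀ x ∈ box d (2 * d * α * t), timeAtZero (fun s => X s ω) t x < a := by
      intro x hx
      by_contra h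
      exact hfail ⟨x, hx, not_lt.1 h⟩
    change IsEastPath (ringTime (Φ ω).1) (fun x n => (Φ ω).2 (x, n)) η (fun s => X s ω) at hω
    intro j hj
    refine ⟨?_, fun x hx => ?_⟩
    · obtain ⟨x, hx, hl, hg⟩ := hω.exists_good_chain hτ ha0.le hat hx₀ hη hlt (N - j) (by omega)
      exact ⟨x, Finset.mem_filter.2 ⟨(hbox x).2 hx, by omega⟩, hg⟩
    · have := hlt x ((hbox x).1 (Finset.mem_filter.1 hx).1)
      rw [hω.timeAtZero_eq hτ ht x] at this
      exact (ENNReal.lt_ofReal_iff_toReal_lt (measure_ne_top _ _)).2 this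
  have hbound : P (zeroEvent p α X t)ᶜ ≤ ENNReal.ofReal (r ^ (N + 1)) := by
    refine hle.trans ?_
    rw [← Measure.map_apply hΦ hFm, hΦlaw, ENNReal.ofReal_pow hr0.le]
    exact measure_failSet_levels_le hp0 hp1 ht0 η (gapLaw d) (level x₀ - N) S
      (fun j x hx => (Finset.mem_filter.1 hx).2) (N + 1)
  calc P.real (zeroEvent p α X t)ᶜ ≤ r ^ (N + 1) :=
        ENNReal.toReal_le_of_le_ofReal (by positivity) hbound
    _ = Real.exp (Real.log r * (N + 1 : ℕ)) := by
        rw [mul_comm, Real.exp_nat_mul, Real.exp_log hr0]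
    _ ≤ 1 * Real.exp (-(-(α * Real.log r)) * t) := by
        rw [one_mul, Real.exp_le_exp, neg_neg, mul_comm α, mul_assoc]
        refine mul_le_mul_of_nonpos_left ?_ (Real.log_neg hr0 hr1).le
        have h1 : ((N : ℤ) : ℝ) = ⌊α * t⌋ := by rw [hNZ]
        push_cast at h1 ⊢
        rw [h1]
        exact (Int.lt_floor_add_one _).le
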